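/- Let $SU(1,1)$ be the group of matrices $\begin{pmatrix} z_1 & z_2\\ \bar z_2 & \bar z_1\end{pmatrix}$ with $|z_1|^2-|z_2|^2=1$, and realise its universal cover $\widetilde{SU}(1,1)$ as $\mathbb R\times\mathbb C$ with the covering map $$\pi(c,w)=\begin{pmatrix}\sqrt{1+|w|^2}\,e^{ic} & w\\ \bar w & \sqrt{1+|w|^2}\,e^{-ic}\end{pmatrix},\qquad \tilde 1=(0,0).$$ Let $Y=\begin{pmatrix}0&i\\-i&0\end{pmatrix}$ and $Z=\begin{pmatrix}-i&0\\0&i\end{pmatrix}$ in $\mathfrak{su}(1,1)$, and let $\widetilde Y,\widetilde Z$ be the lifts to $\widetilde{SU}(1,1)$ of the left-invariant vector fields $g\mapsto gY$, $g\mapsto gZ$. Let $\tilde\rho$ be the lift of the left-invariant Lorentzian metric on $SU(1,1)$ that equals $\tfrac18$ of the Killing form on $\mathfrak{su}(1,1)$, and let $\widetilde E=\operatorname{span}\{\widetilde Y,\widetilde Z\}$. In both the Lorentzian structure $\tilde\rho$ and the sub-Lorentzian structure $(\widetilde E,\tilde\rho|_{\widetilde E})$ the time orientation is $\widetilde Z$.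 The timelike future $\mathcal I^+(\tilde 1,\tilde\rho)$ is the set of end points $\gamma(\tau)$ of absolutely continuous curves $\gamma:[0,\tau]\to\widetilde{SU}(1,1)$, $\tau>0$, with $\gamma(0)=\tilde 1$ and, for almost every $t$, $\tilde\rho(\dot\gamma,\dot\gamma)<0$ and $\tilde\rho(\widetilde Z,\dot\gamma)<0$. The timelike future $\mathcal I^+(\tilde 1,\tilde\rho|_{\widetilde E})$ is defined in the same way, with the additional requirement that $\dot\gamma(t)\in\widetilde E$ for almost every $t$. Then: (a) $\displaystyle \mathcal I^+(\tilde 1,\tilde\rho)=\{(c,w)\in\mathbb R\times\mathbb C : c<-\arctan|w|\}$; (b) $\displaystyle \mathcal I^+(\tilde 1,\tilde\rho|_{\widetilde E})=\Bigl\{(c,w)\in\mathbb R\times\mathbb C : c<\operatorname{Arg}\bigl(1-|\operatorname{Re}w|-i\sqrt{(\operatorname{Im}w)^2+2|\operatorname{Re}w|}\,\bigr)\Bigr\}$, where $\operatorname{Arg}$ is the principal argument with values in $(-\pi,\pi]$. -/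

import Mathlib

open Matrix Complex MeasureTheory
open scoped ComplexConjugate

attribute [local instance] LieRing.ofAssociativeRing

/-- The signature matrix `diag(1, -1)` of the Hermitian form preserved by `SU(1,1)`. -/
def sigMat : Matrix (Fin 2) (Fin 2) ℂ := !![1, 0; 0, -1]

/-- The matrix with first row `(z₁, z₂)` and second row the conjugates `(z̄₂, z̄₁)`. -/
def pairMat (z : ℂ × ℂ) : Matrix (Fin 2) (Fin 2) ℂ := !![z.1, z.2; conj z.2, conj z.1]

/-- The group `SU(1,1)`: complex `2 × 2` matrices of determinant one that preserve the
Hermitian form of signature `(1,1)`. -/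
def SU11 : Subgroup (Matrix.SpecialLinearGroup (Fin 2) ℂ) where
  carrier := {g | (g.1)ᴴ * sigMat * g.1 = sigMat}
  one_mem' := by simp
  mul_mem' := by
    intro a b ha hb
    simp only [Set.mem_ofPred_eq] at ha hb ⊢
    have h : (a * b).1 = a.1 * b.1 := rfl
    rw [h, Matrix.conjTranspose_mul]
    calc (b.1)ᴴ * (a.1)ᴴ * sigMat * (a.1 * b.1)
        = (b.1)ᴴ * ((a.1)ᴴ * sigMat * a.1) * b.1 := by simp only [Matrix.mul_assoc]
      _ = sigMat := by rw [ha, hb]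
  inv_mem' := by
    intro a ha
    simp only [Set.mem_ofPred_eq] at ha ⊢
    have h : a.1 * (a⁻¹).1 = 1 := congrArg Subtype.val (mul_inv_cancel a)
    have h2 : ((a⁻¹).1)ᴴ * (a.1)ᴴ = 1 := by
      rw [← Matrix.conjTranspose_mul, h, Matrix.conjTranspose_one]
    calc ((a⁻¹).1)ᴴ * sigMat * (a⁻¹).1
        = ((a⁻¹).1)ᴴ * ((a.1)ᴴ * sigMat * a.1) * (a⁻¹).1 := by rw [ha]
      _ = (((a⁻¹).1)ᴴ * (a.1)ᴴ) * sigMat * (a.1 * (a⁻¹).1) := by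
          simp only [Matrix.mul_assoc]
      _ = sigMat := by rw [h, h2]; simp

/-- The real Lie algebra `su(1,1)` of `SU(1,1)`. -/
def su11 : LieSubalgebra ℝ (Matrix (Fin 2) (Fin 2) ℂ) where
  carrier := {A | Aᴴ * sigMat + sigMat * A = 0 ∧ A.trace = 0}
  zero_mem' := by simp
  add_mem' := by
    rintro A B ⟨hA, hA'⟩ ⟨hB, hB'⟩
    refine ⟨?_, by simp [hA', hB']⟩
    rw [Matrix.conjTranspose_add, add_mul, mul_add]
    calc _ = (Aᴴ * sigMat + sigMat * A) + (Bᴴ * sigMat + sigMat * B) := by abel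
      _ = 0 := by rw [hA, hB, add_zero]
  smul_mem' := by
    rintro r A ⟨hA, hA'⟩
    refine ⟨?_, by simp [Matrix.trace_smul, hA']⟩
    rw [Matrix.conjTranspose_smul, star_trivial, Matrix.smul_mul, Matrix.mul_smul, ← smul_add, hA,
      smul_zero]
  lie_mem' := by
    rintro A B ⟨hA, -⟩ ⟨hB, -⟩
    refine ⟨?_, by simp [Ring.lie_def, Matrix.trace_sub, Matrix.trace_mul_comm A B]⟩
    have hA2 : Aᴴ * sigMat = -(sigMat * A) := eq_neg_of_add_eq_zero_left hA
    have hB2 : Bᴴ * sigMat = -(sigMat * B) := eq_neg_of_add_eq_zero_left hB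
    rw [Ring.lie_def, Matrix.conjTranspose_sub, Matrix.conjTranspose_mul,
      Matrix.conjTranspose_mul, sub_mul, mul_sub, Matrix.mul_assoc, Matrix.mul_assoc, hA2, hB2,
      mul_neg, mul_neg, ← Matrix.mul_assoc, ← Matrix.mul_assoc, hA2, hB2]
    simp only [neg_mul, neg_neg, Matrix.mul_assoc]
    abel

/-- The universal cover of `SU(1,1)`, realised as `ℝ × ℂ` with coordinates `(c, w)`. -/
abbrev CSU : Type := ℝ × ℂ

/-- The first row `(z₁, z₂) = (√(1 + |w|²) e^{ic}, w)` of the image of `(c, w)` in `SU(1,1)`. -/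
noncomputable def coverRow (q : CSU) : ℂ × ℂ :=
  (((√(1 + ‖q.2‖ ^ 2) : ℝ) : ℂ) * Complex.exp (q.1 * I), q.2)

theorem coverRow_conj (q : CSU) :
    (coverRow q).1 * conj (coverRow q).1 - (coverRow q).2 * conj (coverRow q).2 = 1 := by
  have h : (0 : ℝ) ≤ 1 + ‖q.2‖ ^ 2 := by positivity
  rw [Complex.mul_conj, Complex.mul_conj, Complex.normSq_eq_norm_sq, Complex.normSq_eq_norm_sq]
  simp only [coverRow, norm_mul, Complex.norm_exp_ofReal_mul_I, mul_one, Complex.norm_real,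
    Real.norm_eq_abs, sq_abs, Real.sq_sqrt h]
  push_cast
  ring

/-- The covering homomorphism `π : (c, w) ↦ (z₁, z₂; z̄₂, z̄₁)` onto `SU(1,1)`. -/
noncomputable def coverMap (q : CSU) : SU11 :=
  ⟨⟨pairMat (coverRow q), by
      have h := coverRow_conj q
      simp only [pairMat, Matrix.det_fin_two_of]
      exact h⟩, by
      have h := coverRow_conj q
      change (pairMat (coverRow q))ᴴ * sigMat * pairMat (coverRow q) = sigMat
      ext i j
      fin_cases i <;> fin_cases j <;>
        simp [pairMat, sigMat, Matrix.mul_apply, Fin.sum_univ_two] <;>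
        grind⟩

/-- The derivative of the covering map at `q` applied to a tangent vector `v`, as a matrix. -/
noncomputable def coverDeriv (q v : CSU) : Matrix (Fin 2) (Fin 2) ℂ :=
  pairMat (fderiv ℝ coverRow q v)

theorem coverRow_differentiable : Differentiable ℝ coverRow := by
  have h0 : Differentiable ℝ fun q : CSU => √(1 + ‖q.2‖ ^ 2) := by
    refine Differentiable.sqrt ?_ (fun q => by positivity)
    exact (differentiable_snd.norm_sq ℝ).const_add 1
  have h1 : Differentiable ℝ fun q : CSU => ((√(1 + ‖q.2‖ ^ 2) : ℝ) : ℂ) :=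
    Complex.ofRealCLM.differentiable.comp h0
  have h2 : Differentiable ℝ fun q : CSU => ((q.1 : ℝ) : ℂ) :=
    Complex.ofRealCLM.differentiable.comp differentiable_fst
  exact (h1.mul (h2.mul_const I).cexp).prodMk differentiable_snd

theorem coverRow_deriv_tangent (q v : CSU) :
    (fderiv ℝ coverRow q v).1 * conj (coverRow q).1 + (coverRow q).1 * conj (fderiv ℝ coverRow q v).1
      - ((fderiv ℝ coverRow q v).2 * conj (coverRow q).2
        + (coverRow q).2 * conj (fderiv ℝ coverRow q v).2) = 0 := by
  have hd := (coverRow_differentiable q).hasFDerivAt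
  have h1 := hd.fst
  have h2 := hd.snd
  have h1c := Complex.conjCLE.toContinuousLinearMap.hasFDerivAt.comp q h1
  have h2c := Complex.conjCLE.toContinuousLinearMap.hasFDerivAt.comp q h2
  have h3 := (h1.mul h1c).sub (h2.mul h2c)
  have h4 : HasFDerivAt (fun _ : CSU => (1 : ℂ)) (0 : CSU →L[ℝ] ℂ) q := hasFDerivAt_const _ _
  have h5 := h3.unique (h4.congr_of_eventuallyEq
    (Filter.Eventually.of_forall fun p => coverRow_conj p))
  have h6 := congrArg (fun L : CSU →L[ℝ] ℂ => L v) h5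
  simp at h6
  linear_combination h6

/-- The pull-back to the cover of the Maurer-Cartan form of `SU(1,1)`: the tangent vector `v` at
`q` is sent to `g⁻¹ · dπ(v)` in `su(1,1)`, where `g = π(q)`. This is left translation of `v` to
the identity. -/
noncomputable def mcForm (q v : CSU) : su11 :=
  ⟨((coverMap q)⁻¹ : SU11).1.1 * coverDeriv q v, by
    have h := coverRow_deriv_tangent q v
    have hi : ((coverMap q)⁻¹ : SU11).1.1
        = !![conj (coverRow q).1, -(coverRow q).2; -conj (coverRow q).2, (coverRow q).1] := by
      change Matrix.adjugate (pairMat (coverRow q)) = _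
      simp [pairMat, Matrix.adjugate_fin_two_of]
    rw [hi]
    change _ ∧ _
    constructor
    · ext i j
      fin_cases i <;> fin_cases j <;>
        simp [coverDeriv, pairMat, sigMat, Matrix.mul_apply, Fin.sum_univ_two] <;>
        grind
    · simp [coverDeriv, pairMat, Matrix.trace_fin_two]
      grind⟩

/-- The element `X = (0, -1; -1, 0)` of `su(1,1)`. -/
def lieX : su11 := ⟨!![0, -1; -1, 0], by
  constructor
  · ext i j
    fin_cases i <;> fin_cases j <;> simp [sigMat, Matrix.mul_apply, Fin.sum_univ_two]
  · simp [Matrix.trace_fin_two]⟩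

/-- The element `Y = (0, i; -i, 0)` of `su(1,1)`. -/
def lieY : su11 := ⟨!![0, I; -I, 0], by
  constructor
  · ext i j
    fin_cases i <;> fin_cases j <;> simp [sigMat, Matrix.mul_apply, Fin.sum_univ_two]
  · simp [Matrix.trace_fin_two]⟩

/-- The element `Z = (-i, 0; 0, i)` of `su(1,1)`. -/
def lieZ : su11 := ⟨!![-I, 0; 0, I], by
  constructor
  · ext i j
    fin_cases i <;> fin_cases j <;> simp [sigMat, Matrix.mul_apply, Fin.sum_univ_two]
  · simp [Matrix.trace_fin_two]⟩

/-- The left-invariant vector field on the cover generated by `A ∈ su(1,1)`, i.e. the lift of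
`g ↦ g A`. If `(ζ, ω)` is the first row of `π(q) A` then its value is `(Im (ζ / z₁), ω)`. -/
noncomputable def leftField (A : su11) (q : CSU) : CSU :=
  ((((coverMap q).1.1 * A.1) 0 0 / (coverRow q).1).im, ((coverMap q).1.1 * A.1) 0 1)

theorem coverRow_deriv_snd (q v : CSU) : (fderiv ℝ coverRow q v).2 = v.2 := by
  have h := (coverRow_differentiable q).hasFDerivAt.snd
  have h' : HasFDerivAt (fun p : CSU => (coverRow p).2) (ContinuousLinearMap.snd ℝ ℝ ℂ) q :=
    hasFDerivAt_snd
  exact congrArg (fun L : CSU →L[ℝ] ℂ => L v) (h.unique h')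

theorem coverRow_fst_ne (q : CSU) : (coverRow q).1 ≠ 0 := by
  have h : √(1 + ‖q.2‖ ^ 2) ≠ 0 := (Real.sqrt_pos.2 (by positivity)).ne'
  exact mul_ne_zero (by exact_mod_cast h) (Complex.exp_ne_zero _)

theorem coverRow_deriv_fst (q v : CSU) :
    ((fderiv ℝ coverRow q v).1 / (coverRow q).1).im = v.1 := by
  have h0 : DifferentiableAt ℝ (fun q : CSU => √(1 + ‖q.2‖ ^ 2)) q := by
    refine DifferentiableAt.sqrt ?_ (by positivity)
    exact (differentiable_snd.norm_sq ℝ q).const_add 1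
  have h1 := Complex.ofRealCLM.hasFDerivAt.comp q h0.hasFDerivAt
  have h2 := ((Complex.ofRealCLM.hasFDerivAt.comp q
    (hasFDerivAt_fst (𝕜 := ℝ) (p := q))).mul_const I).cexp
  have h3 := h1.mul h2
  have h := (coverRow_differentiable q).hasFDerivAt.fst
  have h6 := congrArg (fun L : CSU →L[ℝ] ℂ => L v) (h.unique h3)
  have hr : ((√(1 + ‖q.2‖ ^ 2) : ℝ) : ℂ) ≠ 0 := by
    exact_mod_cast (Real.sqrt_pos.2 (by positivity : (0 : ℝ) < 1 + ‖q.2‖ ^ 2)).ne'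
  simp only [ContinuousLinearMap.coe_comp, Function.comp_apply, _root_.add_apply,
    _root_.smul_apply, ContinuousLinearMap.coe_fst', Complex.ofRealCLM_apply,
    smul_eq_mul] at h6
  rw [h6]
  generalize fderiv ℝ (fun q : CSU => √(1 + ‖q.2‖ ^ 2)) q v = d
  have h7 : ∀ u : ℂ, u = ((v.1 : ℝ) : ℂ) * I + ((d / √(1 + ‖q.2‖ ^ 2) : ℝ) : ℂ) →
      u.im = v.1 := by
    rintro u rfl
    simp
  apply h7
  have he := Complex.exp_ne_zero (q.1 * I)
  simp only [coverRow]
  push_cast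
  field_simp

/-- The field `leftField A` is indeed the left-invariant vector field with value `A` at the
identity. -/
theorem mcForm_leftField (A : su11) (q : CSU) : mcForm q (leftField A q) = A := by
  obtain ⟨A, hA, htr⟩ := A
  have h01 := congrFun (congrFun hA 0) 1
  have h00 := congrFun (congrFun hA 0) 0
  have h11 : A 1 1 = -A 0 0 := by
    rw [Matrix.trace_fin_two] at htr
    exact eq_neg_of_add_eq_zero_right htr
  simp [sigMat, Matrix.mul_apply, Fin.sum_univ_two, Matrix.vecMul, dotProduct] at h01 h00
  have hb : A 1 0 = conj (A 0 1) := by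
    have := congrArg conj (eq_neg_of_add_eq_zero_right h01)
    simpa using this.symm
  set v := leftField ⟨A, hA, htr⟩ q with hv
  have hz := coverRow_fst_ne q
  have hv1 : v.1 = (((coverRow q).1 * A 0 0 + (coverRow q).2 * A 1 0) / (coverRow q).1).im := by
    rw [hv]
    simp [leftField, coverMap, pairMat, Matrix.mul_apply, Fin.sum_univ_two]
  have hv2 : v.2 = (coverRow q).1 * A 0 1 + (coverRow q).2 * A 1 1 := by
    rw [hv]
    simp [leftField, coverMap, pairMat, Matrix.mul_apply, Fin.sum_univ_two]
  have d2 := coverRow_deriv_snd q v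
  have d1 := coverRow_deriv_fst q v
  have ht := coverRow_deriv_tangent q v
  have hA0 : conj (A 0 0) = -A 0 0 := by linear_combination h00
  rw [d2, hv2] at ht
  rw [hv1] at d1
  have key : (fderiv ℝ coverRow q v).1
      = (coverRow q).1 * A 0 0 + (coverRow q).2 * A 1 0 := by
    generalize (fderiv ℝ coverRow q v).1 = a at ht d1
    obtain ⟨e, he⟩ : ∃ e, a = (coverRow q).1 * A 0 0 + (coverRow q).2 * A 1 0
        + (coverRow q).1 * e := ⟨(a - ((coverRow q).1 * A 0 0 + (coverRow q).2 * A 1 0))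
          / (coverRow q).1, by field_simp; ring⟩
    rw [he, add_div, Complex.add_im, mul_div_cancel_left₀ _ hz] at d1
    have hei : e.im = 0 := by linarith
    have her : conj e = e := Complex.conj_eq_iff_im.2 hei
    rw [he, h11, hb] at ht
    simp only [map_add, map_mul, map_neg, Complex.conj_conj, hA0, her] at ht
    have h8 : 2 * e * ((coverRow q).1 * conj (coverRow q).1) = 0 := by linear_combination ht
    have hcz : conj (coverRow q).1 ≠ 0 := (map_ne_zero _).2 hz
    have h9 : e = 0 := by simpa [hz] using h8
    rw [he, h9]; ring
  have hD : coverDeriv q v = (coverMap q).1.1 * A := by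
    simp only [coverDeriv]
    rw [show fderiv ℝ coverRow q v = ((fderiv ℝ coverRow q v).1, (fderiv ℝ coverRow q v).2)
      from rfl, key, d2, hv2, h11, hb]
    ext i j
    fin_cases i <;> fin_cases j <;>
      simp [coverMap, pairMat, Matrix.mul_apply, Fin.sum_univ_two, hA0, hb, h11] <;> ring
  apply Subtype.ext
  change ((coverMap q)⁻¹ : SU11).1.1 * coverDeriv q v = A
  rw [hD, ← Matrix.mul_assoc]
  have h1 : ((coverMap q)⁻¹ : SU11).1.1 * (coverMap q).1.1 = 1 :=
    congrArg (fun g : SU11 => g.1.1) (inv_mul_cancel (coverMap q))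
  rw [h1, Matrix.one_mul]

/-- The Lorentzian metric on the cover: the lift of the left-invariant metric of `SU(1,1)` that is
one eighth of the Killing form on `su(1,1)`. -/
noncomputable def lorMetric (q v v' : CSU) : ℝ :=
  (1 / 8) * killingForm ℝ su11 (mcForm q v) (mcForm q v')

/-- The distribution `Ẽ` spanned by the lifts of the left-invariant fields `Y` and `Z`. -/
noncomputable def distE (q : CSU) : Submodule ℝ CSU :=
  Submodule.span ℝ {leftField lieY q, leftField lieZ q}

/-- The timelike future of `q₀` for a distribution `D` with an index one metric `ρ`, given as a
bilinear form on each tangent space (only its restriction to `D` matters), and a time orientation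
`T`: the end points of the absolutely continuous curves `γ : [0, τ] → CSU`, `τ > 0`, that start at
`q₀` and whose velocity is for almost every `t` in `D`, timelike, and future directed. -/
def timelikeFuture (D : CSU → Submodule ℝ CSU) (ρ : CSU → CSU → CSU → ℝ) (T : CSU → CSU)
    (q₀ : CSU) : Set CSU :=
  {q₁ | ∃ (τ : ℝ) (γ : ℝ → CSU), 0 < τ ∧ AbsolutelyContinuousOnInterval γ 0 τ ∧
    γ 0 = q₀ ∧ γ τ = q₁ ∧
    ∀ᵐ t ∂(volume.restrict (Set.Icc 0 τ)), DifferentiableAt ℝ γ t ∧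
      deriv γ t ∈ D (γ t) ∧
      ρ (γ t) (deriv γ t) (deriv γ t) < 0 ∧
      ρ (γ t) (T (γ t)) (deriv γ t) < 0}

/-! By left invariance a future timelike velocity is a matrix `(ia, b; b̄, -ia)` with |b| < -a, and
horizontality adds Re b = 0. Everything becomes a reachability problem for these controls, with
`z₁`, `w` the first row of π.

For (a), Cauchy–Schwarz shows that c + arctan |w| strictly decreases along every admissible curve
(`leftField_fst_add_neg`). Conversely, put θ = arctan |w|: the curve on which c and the arctangent
of the modulus both vary linearly, with the phase of w fixed, is timelike exactly when θ < |c|.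

For (b), write b = iy and use the real functions P = Re z₁ + Re w, U = Im z₁ - Im w, M = Re z₁ - Re
w, V = Im z₁ + Im w, which satisfy PM + UV = 1. The pairs (P, U) and (M, V) each solve a system P' =
lU, U' = -mP with l, m > 0. As long as -π < c < 0 one has U + V < 0, so a zero of P forces U < 0,
and a rotation argument (`lt_one_of_rotating`) gives P < 1; likewise M < 1. Together these say Re z₁
< 1 - |Re w|, which for -π ≤ c ≤ 0 is the stated bound on c (`lt_subBoundary_iff`), while c ≤ -π
satisfies the bound trivially.

Conversely, if U and V are negative, the point is a product of two one-parameter flows of equal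
duration (`exists_two_controls`). All remaining points, including those with c ≤ -π, are reached by
a rotation, a flow through a quarter turn and another rotation (`mem_timelikeFuture_of_phase`). -/

/-! ### Coordinates on su(1,1), the metric and the control cone -/

theorem su11_apply_one_one (A : su11) : A.1 1 1 = -A.1 0 0 := by
  have htr := A.2.2
  rw [Matrix.trace_fin_two] at htr
  exact eq_neg_of_add_eq_zero_right htr

theorem su11_apply_zero_zero_re (A : su11) : (A.1 0 0).re = 0 := by
  have h := congrFun (congrFun A.2.1 0) 0
  simp [sigMat, Matrix.mul_apply, Fin.sum_univ_two, Matrix.vecMul, dotProduct] at h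
  have := congrArg Complex.re h
  simp at this
  linarith

theorem su11_apply_one_zero (A : su11) : A.1 1 0 = conj (A.1 0 1) := by
  have h := congrFun (congrFun A.2.1 0) 1
  simp [sigMat, Matrix.mul_apply, Fin.sum_univ_two, Matrix.vecMul, dotProduct] at h
  have := congrArg conj (eq_neg_of_add_eq_zero_right h)
  simpa using this.symm

/-- The element `(ia, b; b̄, -ia)` of `su(1,1)`. -/
def su11Mk (a : ℝ) (b : ℂ) : su11 := ⟨!![a * I, b; conj b, -(a * I)], by
  constructor
  · ext i j
    fin_cases i <;> fin_cases j <;> simp [sigMat, Matrix.mul_apply, Fin.sum_univ_two]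
  · simp [Matrix.trace_fin_two]⟩

theorem su11_ext {A B : su11} (h0 : (A.1 0 0).im = (B.1 0 0).im) (h1 : A.1 0 1 = B.1 0 1) :
    A = B := by
  have h : A.1 0 0 = B.1 0 0 :=
    Complex.ext (by rw [su11_apply_zero_zero_re, su11_apply_zero_zero_re]) h0
  apply Subtype.ext
  ext i j
  fin_cases i <;> fin_cases j <;>
    simp [su11_apply_one_one, su11_apply_one_zero, h, h1]

/-- The coordinates `(a, Re b, Im b)` of the element `(ia, b; b̄, -ia)` of `su(1,1)`. -/
noncomputable def su11Coord : su11 ≃ₗ[ℝ] (Fin 3 → ℝ) where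
  toFun A := ![(A.1 0 0).im, (A.1 0 1).re, (A.1 0 1).im]
  map_add' A B := by
    ext i; fin_cases i <;> simp
  map_smul' r A := by
    ext i; fin_cases i <;> simp
  invFun x := su11Mk (x 0) ⟨x 1, x 2⟩
  left_inv A := by
    apply su11_ext <;> simp [su11Mk]
  right_inv x := by
    ext i; fin_cases i <;> simp [su11Mk]

/-- The trace of `ad A ∘ ad B` is computed in the coordinates (a, Re b, Im b). The factor 8 is
cancelled by the normalisation of the metric, so the form is |b|² - a². -/
theorem killingForm_su11 (A B : su11) :
    killingForm ℝ su11 A B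
      = 8 * ((A.1 0 1 * conj (B.1 0 1)).re - (A.1 0 0).im * (B.1 0 0).im) := by
  rw [killingForm_apply_apply, LinearMap.trace_eq_matrix_trace ℝ (Module.Basis.ofEquivFun su11Coord)]
  have hA := su11_apply_zero_zero_re A
  have hB := su11_apply_zero_zero_re B
  simp only [Matrix.trace, Fin.sum_univ_three, Matrix.diag_apply, LinearMap.toMatrix_apply,
    Module.Basis.ofEquivFun_repr_apply, Module.Basis.coe_ofEquivFun, LinearMap.comp_apply,
    LieAlgebra.ad_apply]
  simp [su11Coord, su11Mk, LieSubalgebra.coe_bracket, Ring.lie_def, Matrix.mul_apply,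
    Fin.sum_univ_two, Matrix.vecMul, dotProduct, su11_apply_one_one, su11_apply_one_zero, hA, hB]
  ring

theorem su11Mk_surjective (A : su11) : ∃ a b, A = su11Mk a b :=
  ⟨(A.1 0 0).im, A.1 0 1, by apply su11_ext <;> simp [su11Mk]⟩

theorem coverDeriv_eq (q v : CSU) :
    coverDeriv q v = pairMat (coverRow q) * (mcForm q v).1 := by
  have h1 : (coverMap q).1.1 * ((coverMap q)⁻¹ : SU11).1.1 = 1 :=
    congrArg (fun g : SU11 => g.1.1) (mul_inv_cancel (coverMap q))
  change _ = (coverMap q).1.1 * (((coverMap q)⁻¹ : SU11).1.1 * coverDeriv q v)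
  rw [← Matrix.mul_assoc, h1, Matrix.one_mul]

theorem fderiv_coverRow_of_mcForm {q v : CSU} {a : ℝ} {b : ℂ} (h : mcForm q v = su11Mk a b) :
    fderiv ℝ coverRow q v
      = ((coverRow q).1 * (a * I) + (coverRow q).2 * conj b,
        (coverRow q).1 * b - (coverRow q).2 * (a * I)) := by
  have h0 := coverDeriv_eq q v
  rw [h] at h0
  have h1 := congrFun (congrFun h0 0) 0
  have h2 := congrFun (congrFun h0 0) 1
  simp [coverDeriv, pairMat, su11Mk, Matrix.mul_apply, Fin.sum_univ_two] at h1 h2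
  exact Prod.ext h1 (by rw [h2]; ring)

/-- The derivative of the first row determines the tangent vector: its second entry is the
w-component, and the imaginary part of dz₁ / z₁ is the c-component. Hence every tangent vector is
the value of a left-invariant field. -/
theorem mcForm_injective (q : CSU) : Function.Injective (mcForm q) := by
  intro v v' h
  obtain ⟨a, b, hab⟩ := su11Mk_surjective (mcForm q v)
  have h1 := fderiv_coverRow_of_mcForm hab
  have h2 := fderiv_coverRow_of_mcForm (h.symm.trans hab)
  rw [← h2] at h1
  refine Prod.ext ?_ ?_
  · rw [← coverRow_deriv_fst q v, ← coverRow_deriv_fst q v', h1]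
  · rw [← coverRow_deriv_snd q v, ← coverRow_deriv_snd q v', h1]

theorem leftField_mcForm (q v : CSU) : leftField (mcForm q v) q = v :=
  mcForm_injective q (mcForm_leftField _ _)

theorem leftField_su11Mk (a : ℝ) (b : ℂ) (q : CSU) :
    leftField (su11Mk a b) q
      = (a + ((coverRow q).2 * conj b / (coverRow q).1).im,
        (coverRow q).1 * b - (coverRow q).2 * (a * I)) := by
  have hz := coverRow_fst_ne q
  refine Prod.ext ?_ ?_
  · simp [leftField, su11Mk, coverMap, pairMat, Matrix.mul_apply, Fin.sum_univ_two, add_div,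
      mul_div_cancel_left₀ _ hz]
  · simp [leftField, su11Mk, coverMap, pairMat, Matrix.mul_apply, Fin.sum_univ_two]
    ring

theorem leftField_linear (q : CSU) (s t : ℝ) (A B : su11) :
    leftField (s • A + t • B) q = s • leftField A q + t • leftField B q := by
  refine Prod.ext ?_ ?_
  · simp [leftField, Matrix.mul_add, add_div, mul_div_assoc]
  · simp [leftField, Matrix.mul_add]

theorem leftField_mem_distE_iff (q : CSU) (a : ℝ) (b : ℂ) :
    leftField (su11Mk a b) q ∈ distE q ↔ b.re = 0 := by
  rw [distE, Submodule.mem_span_pair]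
  constructor
  · rintro ⟨s, t, h⟩
    rw [← leftField_linear] at h
    have h1 := congrArg (mcForm q) h
    rw [mcForm_leftField, mcForm_leftField] at h1
    have h2 := congrArg (fun A : su11 => (A.1 0 1).re) h1
    simp [su11Mk, lieY, lieZ] at h2
    exact h2.symm
  · intro hb
    refine ⟨b.im, -a, ?_⟩
    rw [← leftField_linear]
    congr 1
    apply su11_ext
    · simp [su11Mk, lieY, lieZ]
    · apply Complex.ext <;> simp [su11Mk, lieY, lieZ, hb]

theorem lorMetric_leftField (q : CSU) (A B : su11) :
    lorMetric q (leftField A q) (leftField B q)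
      = (A.1 0 1 * conj (B.1 0 1)).re - (A.1 0 0).im * (B.1 0 0).im := by
  rw [lorMetric, mcForm_leftField, mcForm_leftField, killingForm_su11]
  ring

theorem timelike_future_leftField_iff (q : CSU) (a : ℝ) (b : ℂ) :
    (lorMetric q (leftField (su11Mk a b) q) (leftField (su11Mk a b) q) < 0 ∧
      lorMetric q (leftField lieZ q) (leftField (su11Mk a b) q) < 0) ↔ ‖b‖ < -a := by
  rw [lorMetric_leftField, lorMetric_leftField]
  have h1 : (b * conj b).re = ‖b‖ ^ 2 := by
    rw [Complex.mul_conj, Complex.normSq_eq_norm_sq, Complex.ofReal_re]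
  simp only [su11Mk, lieZ]
  simp only [Matrix.of_apply, Matrix.cons_val', Matrix.cons_val_zero, Matrix.cons_val_one,
    Matrix.cons_val_fin_one, h1]
  simp
  have := norm_nonneg b
  constructor
  · rintro ⟨h2, h3⟩
    nlinarith
  · intro h
    constructor <;> nlinarith

/-! ### Absolutely continuous functions and concatenation of curves -/

-- Monotonicity keeps disjoint intervals disjoint and the Lipschitz bound does not increase their
-- total length. This serves the clamped time changes used to concatenate curves.
open Set in
theorem AbsolutelyContinuousOnInterval.comp_monotone_lipschitz {X : Type*} [PseudoMetricSpace X]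
    {f : ℝ → X} {φ : ℝ → ℝ} {a b c d : ℝ} (hf : AbsolutelyContinuousOnInterval f c d)
    (hφ : Monotone φ) (hφ1 : LipschitzWith 1 φ) (hm : ∀ x ∈ uIcc a b, φ x ∈ uIcc c d) :
    AbsolutelyContinuousOnInterval (fun t => f (φ t)) a b := by
  rw [absolutelyContinuousOnInterval_iff] at hf ⊢
  intro ε hε
  obtain ⟨δ, hδ, h⟩ := hf ε hε
  refine ⟨δ, hδ, fun E hE hEd => ?_⟩
  refine h (E.1, fun i => (φ (E.2 i).1, φ (E.2 i).2)) ⟨fun i hi => ?_, ?_⟩ ?_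
  · exact ⟨hm _ (hE.1 i hi).1, hm _ (hE.1 i hi).2⟩
  · intro i hi j hj hij
    have h0 := hE.2 hi hj hij
    simp only [Function.onFun, uIoc, Ioc_disjoint_Ioc] at h0 ⊢
    have h1 := hφ h0
    simp only [hφ.map_max, hφ.map_min] at h1
    exact h1
  · refine lt_of_le_of_lt (Finset.sum_le_sum fun i _ => ?_) hEd
    simpa using hφ1.dist_le_mul (E.2 i).1 (E.2 i).2

theorem LipschitzWith.comp_absolutelyContinuousOnInterval {X Y : Type*} [PseudoMetricSpace X]
    [PseudoMetricSpace Y] {f : ℝ → X} {g : X → Y} {a b : ℝ} (hg : LipschitzWith 1 g)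
    (hf : AbsolutelyContinuousOnInterval f a b) :
    AbsolutelyContinuousOnInterval (fun t => g (f t)) a b := by
  rw [absolutelyContinuousOnInterval_iff] at hf ⊢
  intro ε hε
  obtain ⟨δ, hδ, h⟩ := hf ε hε
  refine ⟨δ, hδ, fun E hE hEd => lt_of_le_of_lt (Finset.sum_le_sum fun i _ => ?_) (h E hE hEd)⟩
  simpa using hg.dist_le_mul (f (E.2 i).1) (f (E.2 i).2)

theorem absolutelyContinuousOnInterval_const {X : Type*} [PseudoMetricSpace X] (x : X) (a b : ℝ) :
    AbsolutelyContinuousOnInterval (fun _ : ℝ => x) a b :=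
  ((LipschitzWith.const x).lipschitzOnWith (K := 0)).absolutelyContinuousOnInterval

-- By the fundamental theorem of calculus the increment is the integral of the derivative, and an
-- almost everywhere negative integrand over an interval of positive length has negative integral.
open Set in
theorem AbsolutelyContinuousOnInterval.lt_of_ae_deriv_neg {f : ℝ → ℝ} {a b s t : ℝ}
    (hf : AbsolutelyContinuousOnInterval f a b) (has : a ≤ s) (hst : s < t) (htb : t ≤ b)
    (hd : ∀ᵐ x, x ∈ Ioo s t → deriv f x < 0) : f t < f s := by
  have hf' : AbsolutelyContinuousOnInterval f s t := hf.mono (by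
    rw [uIcc_of_le hst.le, uIcc_of_le (by linarith)]; exact Icc_subset_Icc has htb)
  have hi := hf'.intervalIntegrable_deriv
  rw [← sub_neg, ← hf'.integral_deriv_eq_sub, ← neg_pos, ← intervalIntegral.integral_neg]
  have hae : ∀ᵐ x ∂(volume.restrict (Ioc s t)), deriv f x < 0 := by
    rw [← restrict_Ioo_eq_restrict_Ioc]
    exact (ae_restrict_iff' measurableSet_Ioo).2 hd
  rw [intervalIntegral.integral_pos_iff_support_of_nonneg_ae' (f := fun x => -deriv f x) ?_
    hi.neg]
  · refine ⟨hst, ?_⟩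
    refine ((Measure.measure_Ioo_pos volume).2 hst).trans_le (measure_mono_ae ?_)
    filter_upwards [hd] with x hx hx'
    exact ⟨by simpa using (hx hx').ne, Ioo_subset_Ioc_self hx'⟩
  · rw [uIoc_of_le hst.le]
    filter_upwards [hae] with x hx
    simpa using hx.le

/-- Future timelike curves can be concatenated. -/
theorem timelikeFuture_trans {D : CSU → Submodule ℝ CSU} {ρ : CSU → CSU → CSU → ℝ}
    {T : CSU → CSU} {q₀ q₁ q₂ : CSU} (h1 : q₁ ∈ timelikeFuture D ρ T q₀)
    (h2 : q₂ ∈ timelikeFuture D ρ T q₁) : q₂ ∈ timelikeFuture D ρ T q₀ := by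
  obtain ⟨τ₁, γ₁, hτ₁, hac₁, h10, h11, hd1⟩ := h1
  obtain ⟨τ₂, γ₂, hτ₂, hac₂, h20, h21, hd2⟩ := h2
  -- Since the cover is a vector space, concatenation can be written as a sum with clamped times. On
  -- each side of `τ₁` one of the first two terms is constantly `q₁` and cancels the last, so
  -- absolute continuity needs no case split.
  refine ⟨τ₁ + τ₂, fun t => γ₁ (min t τ₁) + γ₂ (max (t - τ₁) 0) - q₁, by positivity, ?_, ?_, ?_, ?_⟩
  · refine AbsolutelyContinuousOnInterval.sub (f := fun t => γ₁ (min t τ₁) + γ₂ (max (t - τ₁) 0))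
      (g := fun _ => q₁) (AbsolutelyContinuousOnInterval.add (f := fun t => γ₁ (min t τ₁))
      (g := fun t => γ₂ (max (t - τ₁) 0)) ?_ ?_)
      (absolutelyContinuousOnInterval_const _ _ _)
    · refine hac₁.comp_monotone_lipschitz (φ := fun t => min t τ₁) ?_ ?_ ?_
      · exact fun x y h => min_le_min_right _ h
      · exact LipschitzWith.id.min_const _
      · intro x hx
        rw [Set.uIcc_of_le (by positivity)] at hx ⊢
        exact ⟨le_min hx.1 hτ₁.le, min_le_right _ _⟩
    · refine hac₂.comp_monotone_lipschitz (φ := fun t => max (t - τ₁) 0) ?_ ?_ ?_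
      · exact fun x y h => max_le_max_right _ (sub_le_sub_right h _)
      · exact (LipschitzWith.of_dist_le_mul fun x y => by simp).max_const _
      · intro x hx
        rw [Set.uIcc_of_le (by positivity)] at hx ⊢
        exact ⟨le_max_right _ _, max_le (by linarith [hx.2]) hτ₂.le⟩
  · simp [hτ₁.le, h10, h20]
  · simp [hτ₂.le, h11, h21]
  · rw [ae_restrict_iff' measurableSet_Icc] at hd1 hd2 ⊢
    have hd2' := (measurePreserving_sub_right volume τ₁).quasiMeasurePreserving.ae hd2
    filter_upwards [hd1, hd2', Measure.ae_ne volume τ₁] with t ht1 ht2 hne ht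
    rcases lt_or_gt_of_ne hne with hlt | hgt
    · have he : (fun t => γ₁ (min t τ₁) + γ₂ (max (t - τ₁) 0) - q₁) =ᶠ[nhds t] γ₁ := by
        filter_upwards [eventually_lt_nhds hlt] with s hs
        rw [min_eq_left hs.le, max_eq_right (by linarith), h20]
        simp
      rw [he.differentiableAt_iff, he.deriv_eq, he.eq_of_nhds]
      exact ht1 ⟨ht.1, hlt.le⟩
    · have he : (fun t => γ₁ (min t τ₁) + γ₂ (max (t - τ₁) 0) - q₁)
          =ᶠ[nhds t] fun s => γ₂ (s - τ₁) := by
        filter_upwards [eventually_gt_nhds hgt] with s hs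
        rw [min_eq_right hs.le, max_eq_left (by linarith), h11]
        simp
      rw [he.differentiableAt_iff, he.deriv_eq, he.eq_of_nhds, deriv_comp_sub_const]
      have h3 := ht2 ⟨by linarith, by linarith [ht.2]⟩
      exact ⟨differentiableAt_comp_sub_const.2 h3.1, h3.2⟩

/-- An integral curve of controls in the future timelike cone ends in the timelike future. -/
theorem mem_timelikeFuture_of_hasDerivAt {D : CSU → Submodule ℝ CSU} {γ : ℝ → CSU} {τ : ℝ}
    (hτ : 0 < τ) (hac : AbsolutelyContinuousOnInterval γ 0 τ)
    (hd : ∀ t ∈ Set.Ioo 0 τ, ∃ a b, HasDerivAt γ (leftField (su11Mk a b) (γ t)) t ∧ ‖b‖ < -a ∧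
      leftField (su11Mk a b) (γ t) ∈ D (γ t)) :
    γ τ ∈ timelikeFuture D lorMetric (leftField lieZ) (γ 0) := by
  refine ⟨τ, γ, hτ, hac, rfl, rfl, ?_⟩
  rw [← restrict_Ioo_eq_restrict_Icc, ae_restrict_iff' measurableSet_Ioo]
  refine Filter.Eventually.of_forall fun t ht => ?_
  obtain ⟨a, b, h1, h2, h3⟩ := hd t ht
  rw [h1.deriv]
  exact ⟨h1.differentiableAt, h3, (timelike_future_leftField_iff _ _ _).2 h2⟩

/-! ### The Lorentzian future -/

theorem norm_sq_coverRow_fst (q : CSU) : ‖(coverRow q).1‖ ^ 2 = 1 + ‖q.2‖ ^ 2 := by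
  have h := coverRow_conj q
  rw [Complex.mul_conj, Complex.mul_conj, Complex.normSq_eq_norm_sq,
    Complex.normSq_eq_norm_sq] at h
  have h2 : (coverRow q).2 = q.2 := rfl
  rw [h2] at h
  have : ‖(coverRow q).1‖ ^ 2 - ‖q.2‖ ^ 2 = 1 := by exact_mod_cast h
  linarith

theorem norm_snd_lt_norm_coverRow_fst (q : CSU) : ‖q.2‖ < ‖(coverRow q).1‖ := by
  have h := norm_sq_coverRow_fst q
  nlinarith [norm_nonneg q.2, norm_nonneg (coverRow q).1]

/-- The speed of `c` along a future timelike control is negative. -/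
theorem leftField_fst_neg (q : CSU) {a : ℝ} {b : ℂ} (h : ‖b‖ < -a) :
    (leftField (su11Mk a b) q).1 < 0 := by
  rw [leftField_su11Mk]
  have h0 : ‖(coverRow q).2 * conj b / (coverRow q).1‖ ≤ ‖b‖ := by
    have hz : 0 < ‖(coverRow q).1‖ := norm_pos_iff.2 (coverRow_fst_ne q)
    rw [norm_div, norm_mul, Complex.norm_conj, div_le_iff₀ hz, mul_comm]
    exact mul_le_mul_of_nonneg_left (norm_snd_lt_norm_coverRow_fst q).le (norm_nonneg b)
  have h1 := (Complex.abs_im_le_norm ((coverRow q).2 * conj b / (coverRow q).1))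
  have h2 := le_abs_self ((coverRow q).2 * conj b / (coverRow q).1).im
  change a + ((coverRow q).2 * conj b / (coverRow q).1).im < 0
  linarith

theorem exists_control_of_future {q v : CSU} (h1 : lorMetric q v v < 0)
    (h2 : lorMetric q (leftField lieZ q) v < 0) :
    ∃ a b, v = leftField (su11Mk a b) q ∧ ‖b‖ < -a := by
  obtain ⟨a, b, hab⟩ := su11Mk_surjective (mcForm q v)
  have hv : v = leftField (su11Mk a b) q := by rw [← hab, leftField_mcForm]
  refine ⟨a, b, hv, (timelike_future_leftField_iff q a b).1 ?_⟩
  rw [← hv]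
  exact ⟨h1, h2⟩

/-- Cauchy–Schwarz for (x, y) against (1/N, -1). -/
theorem re_add_im_bound {x y N : ℝ} (hN : 0 < N) :
    x / N - y ≤ √(x ^ 2 + y ^ 2) * √(1 + N ^ 2) / N := by
  rw [← Real.sqrt_mul (by positivity), le_div_iff₀ hN]
  apply Real.le_sqrt_of_sq_le
  have : (x / N - y) * N = x - y * N := by field_simp
  rw [this]
  nlinarith [sq_nonneg (x * N + y)]

/-- Along a future timelike control, `c + arctan |w|` decreases. -/
theorem leftField_fst_add_neg (q : CSU) {a : ℝ} {b : ℂ} (h : ‖b‖ < -a) (hq : q.2 ≠ 0) :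
    (leftField (su11Mk a b) q).1
      + (conj q.2 * (leftField (su11Mk a b) q).2).re / ‖q.2‖ / (1 + ‖q.2‖ ^ 2) < 0 := by
  have hr := norm_sq_coverRow_fst q
  have hz := coverRow_fst_ne q
  rw [leftField_su11Mk]
  have h2 : (coverRow q).2 = q.2 := rfl
  simp only [h2]
  set z := (coverRow q).1 with hzdef
  -- The single number η carries both effects of b: its imaginary part enters the speed of c, its
  -- real part the speed of |w|.
  set η := conj q.2 * z * b with hη
  have e1 : (q.2 * conj b / z).im = -η.im / (1 + ‖q.2‖ ^ 2) := by
    have : q.2 * conj b / z = conj η / ((‖z‖ ^ 2 : ℝ) : ℂ) := by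
      rw [← Complex.normSq_eq_norm_sq, ← Complex.mul_conj, hη]
      have hzc : conj z ≠ 0 := (map_ne_zero _).2 hz
      simp only [map_mul, Complex.conj_conj]
      field_simp
    rw [this, Complex.div_ofReal_im, hr, Complex.conj_im]
  have e2 : (conj q.2 * (z * b - q.2 * (a * I))).re = η.re := by
    have : conj q.2 * (z * b - q.2 * (a * I)) = η - ((Complex.normSq q.2 * a : ℝ) : ℂ) * I := by
      push_cast
      rw [Complex.normSq_eq_conj_mul_self, hη]; ring
    rw [this]; simp
  rw [e1, e2]
  have hN : 0 < ‖q.2‖ := norm_pos_iff.2 hq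
  have hb := re_add_im_bound (x := η.re) (y := η.im) hN
  have hnη : √(η.re ^ 2 + η.im ^ 2) = ‖q.2‖ * ‖z‖ * ‖b‖ := by
    rw [← Complex.norm_eq_sqrt_sq_add_sq, hη, norm_mul, norm_mul, Complex.norm_conj]
  have hnz : √(1 + ‖q.2‖ ^ 2) = ‖z‖ := by rw [← hr]; exact Real.sqrt_sq (norm_nonneg _)
  rw [hnη, hnz] at hb
  have h3 : ‖q.2‖ * ‖z‖ * ‖b‖ * ‖z‖ / ‖q.2‖ = ‖b‖ * (1 + ‖q.2‖ ^ 2) := by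
    rw [← hr]; field_simp
  rw [h3] at hb
  have h4 : a + -η.im / (1 + ‖q.2‖ ^ 2) + η.re / ‖q.2‖ / (1 + ‖q.2‖ ^ 2)
      = a + (η.re / ‖q.2‖ - η.im) / (1 + ‖q.2‖ ^ 2) := by ring
  rw [h4]
  have h5 : (η.re / ‖q.2‖ - η.im) / (1 + ‖q.2‖ ^ 2) ≤ ‖b‖ :=
    (div_le_iff₀ (by positivity)).2 hb
  linarith

theorem lipschitzWith_arctan : LipschitzWith 1 Real.arctan := by
  refine lipschitzWith_of_nnnorm_deriv_le Real.differentiable_arctan fun x => ?_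
  rw [Real.deriv_arctan, ← NNReal.coe_le_coe, coe_nnnorm, Real.norm_eq_abs,
    abs_of_pos (by positivity), NNReal.coe_one, div_le_one (by positivity)]
  nlinarith [sq_nonneg x]

theorem norm_deriv_mul_norm {w : ℝ → ℂ} {w' : ℂ} {t d : ℝ} (hw : HasDerivAt w w' t)
    (hd : HasDerivAt (fun s => ‖w s‖) d t) : ‖w t‖ * d = (conj (w t) * w').re := by
  have h1 := hd.pow 2
  have h2 := hw.norm_sq
  have h3 := h1.unique h2
  rw [Complex.inner] at h3
  simp at h3 ⊢
  linarith

theorem fst_lt_neg_arctan_of_mem {q : CSU}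
    (h : q ∈ timelikeFuture (fun _ => ⊤) lorMetric (leftField lieZ) (0, 0)) :
    q.1 < -Real.arctan ‖q.2‖ := by
  obtain ⟨τ, γ, hτ, hac, h0, rfl, hd⟩ := h
  have hac1 : AbsolutelyContinuousOnInterval (fun t => (γ t).1) 0 τ :=
    LipschitzWith.prod_fst.comp_absolutelyContinuousOnInterval hac
  have hac2 : AbsolutelyContinuousOnInterval (fun t => (γ t).2) 0 τ :=
    LipschitzWith.prod_snd.comp_absolutelyContinuousOnInterval hac
  have hacn : AbsolutelyContinuousOnInterval (fun t => ‖(γ t).2‖) 0 τ :=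
    lipschitzWith_one_norm.comp_absolutelyContinuousOnInterval hac2
  have hf := hac1.add (lipschitzWith_arctan.comp_absolutelyContinuousOnInterval hacn)
  have hlt := hf.lt_of_ae_deriv_neg le_rfl hτ le_rfl ?_
  · simp [h0] at hlt
    linarith
  · rw [ae_restrict_iff' measurableSet_Icc] at hd
    filter_upwards [hd, hacn.ae_differentiableAt] with t ht hn htm
    have htI : t ∈ Set.Icc 0 τ := Set.Ioo_subset_Icc_self htm
    obtain ⟨hdiff, -, hl1, hl2⟩ := ht htI
    have hn' := (hn (by rwa [Set.uIcc_of_le hτ.le])).hasDerivAt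
    obtain ⟨a, b, hv, hab⟩ := exists_control_of_future hl1 hl2
    have hγ := hdiff.hasDerivAt
    rw [hv] at hγ
    have hc : HasDerivAt (fun s => (γ s).1) (leftField (su11Mk a b) (γ t)).1 t :=
      (ContinuousLinearMap.fst ℝ ℝ ℂ).hasFDerivAt.comp_hasDerivAt t hγ
    have hw : HasDerivAt (fun s => (γ s).2) (leftField (su11Mk a b) (γ t)).2 t :=
      (ContinuousLinearMap.snd ℝ ℝ ℂ).hasFDerivAt.comp_hasDerivAt t hγ
    have hder := hc.add hn'.arctan
    have hdd := hder.deriv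
    change deriv (fun t => (γ t).1 + Real.arctan ‖(γ t).2‖) t < 0
    change deriv (fun t => (γ t).1 + Real.arctan ‖(γ t).2‖) t = _ at hdd
    rw [hdd]
    have hrel := norm_deriv_mul_norm hw hn'
    -- Where |w| vanishes it has a minimum, so its derivative there, when it exists, is zero and
    -- only the speed of c remains.
    by_cases hz : (γ t).2 = 0
    · have hmin : IsLocalMin (fun s => ‖(γ s).2‖) t :=
        Filter.Eventually.of_forall fun s => by simp [hz]
      rw [hmin.deriv_eq_zero]
      have := leftField_fst_neg (γ t) hab
      simpa using this
    · have hN : ‖(γ t).2‖ ≠ 0 := norm_ne_zero_iff.2 hz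
      have h1 := leftField_fst_add_neg (γ t) hab hz
      rw [← hrel, mul_div_cancel_left₀ _ hN] at h1
      convert h1 using 2
      ring

theorem coverRow_fst_eq (q : CSU) :
    (coverRow q).1 = ((√(1 + ‖q.2‖ ^ 2) : ℝ) : ℂ) * Complex.exp (q.1 * I) := rfl

/-- The curve is t ↦ (tc, tan(tθ) ω) with θ = arctan |w| and ω a unit vector in the direction of w.
-/
theorem mem_timelikeFuture_of_fst_lt {q : CSU} (h : q.1 < -Real.arctan ‖q.2‖) :
    q ∈ timelikeFuture (fun _ => ⊤) lorMetric (leftField lieZ) (0, 0) := by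
  obtain ⟨c, w⟩ := q
  simp only at h
  obtain ⟨ω, hω, hw⟩ : ∃ ω : ℂ, ‖ω‖ = 1 ∧ w = ‖w‖ * ω := by
    by_cases hw : w = 0
    · exact ⟨1, by simp, by simp [hw]⟩
    · have hn : (‖w‖ : ℂ) ≠ 0 := by exact_mod_cast norm_ne_zero_iff.2 hw
      refine ⟨w / ‖w‖, ?_, by field_simp⟩
      rw [norm_div, Complex.norm_real, norm_norm, div_self (norm_ne_zero_iff.2 hw)]
  set θ := Real.arctan ‖w‖ with hθ
  have hθ0 : 0 ≤ θ := Real.arctan_nonneg.2 (norm_nonneg w)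
  have hθ1 : θ < Real.pi / 2 := Real.arctan_lt_pi_div_two _
  have hcos : ∀ t ∈ Set.Icc (0 : ℝ) 1, Real.cos (t * θ) ≠ 0 := fun t ht =>
    (Real.cos_pos_of_mem_Ioo ⟨by nlinarith [ht.1, Real.pi_pos], by nlinarith [ht.2]⟩).ne'
  let γ : ℝ → CSU := fun t => (t * c, (Real.tan (t * θ) : ℂ) * ω)
  have h1 : γ 1 = (c, w) := by
    simp only [γ, one_mul, hθ, Real.tan_arctan]
    rw [← hw]
  have h0 : γ 0 = (0, 0) := by simp [γ]
  have hder : ∀ t ∈ Set.Icc (0 : ℝ) 1,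
      HasDerivAt γ (c, ((θ * (1 + Real.tan (t * θ) ^ 2) : ℝ) : ℂ) * ω) t := by
    intro t ht
    refine HasDerivAt.prodMk (by simpa using (hasDerivAt_id t).mul_const c) ?_
    refine HasDerivAt.mul_const (HasDerivAt.ofReal_comp ?_) ω
    have ht1 := (Real.hasDerivAt_tan (hcos t ht)).comp t ((hasDerivAt_id t).mul_const θ)
    refine ht1.congr_deriv ?_
    have hc2 := hcos t ht
    rw [Real.tan_eq_sin_div_cos]
    field_simp
    rw [Real.cos_sq_add_sin_sq]
    simp
  rw [← h1, ← h0]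
  refine mem_timelikeFuture_of_hasDerivAt one_pos ?_ fun t ht => ?_
  · refine ContDiffOn.absolutelyContinuousOnInterval fun t ht => ContDiffAt.contDiffWithinAt ?_
    rw [Set.uIcc_of_le zero_le_one] at ht
    refine ContDiffAt.prodMk (contDiffAt_id.mul contDiffAt_const) ?_
    refine ContDiffAt.mul (Complex.ofRealCLM.contDiff.contDiffAt.comp t ?_) contDiffAt_const
    exact (Real.contDiffAt_tan.2 (hcos t ht)).comp t (contDiffAt_id.mul contDiffAt_const)
  · have htI : t ∈ Set.Icc (0 : ℝ) 1 := Set.Ioo_subset_Icc_self ht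
    have hd := hder t htI
    set T := Real.tan (t * θ) with hT
    have hT2 : ‖(γ t).2‖ ^ 2 = T ^ 2 := by
      simp only [γ, norm_mul, hω, mul_one, Complex.norm_real, Real.norm_eq_abs, sq_abs, ← hT]
    set r := √(1 + T ^ 2) with hr
    have hr0 : 0 < r := Real.sqrt_pos.2 (by positivity)
    have hr2 : r ^ 2 = 1 + T ^ 2 := Real.sq_sqrt (by positivity)
    have hz : (coverRow (γ t)).1 = (r : ℂ) * Complex.exp ((t * c : ℝ) * I) := by
      rw [coverRow_fst_eq, hT2]
    have hz2 : (coverRow (γ t)).2 = (T : ℂ) * ω := rfl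
    have hωω : ω * conj ω = 1 := by
      rw [Complex.mul_conj, Complex.normSq_eq_norm_sq, hω]; simp
    set e := Complex.exp ((t * c : ℝ) * I) with he
    have hee : e * conj e = 1 := by
      rw [Complex.mul_conj, Complex.normSq_eq_norm_sq, he, Complex.norm_exp_ofReal_mul_I]; simp
    -- These controls come from solving `leftField (su11Mk a b) (γ t) = γ' t` for a and b.
    refine ⟨r ^ 2 * c, conj e * ω * r * (θ + T * c * I), ?_, ?_, trivial⟩
    · have hrc : (r : ℂ) ≠ 0 := by exact_mod_cast hr0.ne'
      have he0 : e ≠ 0 := Complex.exp_ne_zero _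
      convert hd using 1
      rw [leftField_su11Mk, hz, hz2]
      have hr2c : (r : ℂ) ^ 2 = 1 + T ^ 2 := by exact_mod_cast hr2
      refine Prod.ext ?_ ?_
      · have : (T : ℂ) * ω * conj (conj e * ω * r * (θ + T * c * I)) / (r * e)
            = ((T * θ : ℝ) : ℂ) - ((T ^ 2 * c : ℝ) : ℂ) * I := by
          simp only [map_mul, map_add, Complex.conj_conj, Complex.conj_ofReal, Complex.conj_I]
          rw [div_eq_iff (mul_ne_zero hrc he0)]
          push_cast
          linear_combination (T * e * r * (θ - T * c * I) : ℂ) * hωω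
        simp only [this]
        simp [hr2]
        simp [← Complex.ofReal_pow]
        ring
      · simp only
        push_cast
        rw [← hr2c]
        linear_combination (r ^ 2 * ω * (θ + T * c * I) : ℂ) * hee
    · rw [norm_mul, norm_mul, norm_mul, Complex.norm_conj, hω, he, Complex.norm_exp_ofReal_mul_I,
        Complex.norm_real, Real.norm_eq_abs, abs_of_pos hr0, one_mul, one_mul]
      have h5 : ‖(θ + T * c * I : ℂ)‖ ^ 2 = θ ^ 2 + (T * c) ^ 2 := by
        rw [← Complex.normSq_eq_norm_sq, ← Complex.ofReal_mul, Complex.normSq_add_mul_I]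
      -- After squaring, T²c² cancels because r² = 1 + T², and what is left is θ² < c².
      have h6 : ‖(θ + T * c * I : ℂ)‖ < r * (-c) := by
        refine lt_of_pow_lt_pow_left₀ 2 (by nlinarith) ?_
        have h7 : θ ^ 2 < c ^ 2 := by nlinarith
        rw [h5, mul_pow, mul_pow, hr2, neg_sq]
        linarith
      nlinarith

/-! ### The sub-Lorentzian future: the necessary condition -/

open Set in
/-- For `P' = lU`, `U' = -mP` with `l, m > 0`, started at `(1, 0)`: if `U < 0` whenever `P = 0`,
then `P < 1` afterwards. -/
theorem lt_one_of_rotating {P U : ℝ → ℝ} {τ : ℝ} (hτ : 0 < τ)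
    (hP : AbsolutelyContinuousOnInterval P 0 τ) (hU : AbsolutelyContinuousOnInterval U 0 τ)
    (hP0 : P 0 = 1) (hU0 : U 0 = 0)
    (hd : ∀ᵐ t, t ∈ Icc 0 τ → ∃ l m : ℝ, 0 < l ∧ 0 < m ∧ HasDerivAt P (l * U t) t ∧
      HasDerivAt U (-(m * P t)) t)
    (hneg : ∀ t ∈ Ioc 0 τ, P t = 0 → U t < 0) : P τ < 1 := by
  by_contra! hge
  have hPc : ContinuousOn P (Icc 0 τ) := by simpa [uIcc_of_le hτ.le] using hP.continuousOn
  have hUc : ContinuousOn U (Icc 0 τ) := by simpa [uIcc_of_le hτ.le] using hU.continuousOn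
  -- Here `t₀` is the last time with P ≤ 0, or 0 if P stays positive. After it, P > 0 drives U below
  -- zero, so P decreases strictly from a value at most 1, against P τ ≥ 1.
  obtain ⟨t₀, ht₀, hτ₀, hpos, hP1, hU1⟩ : ∃ t₀, 0 ≤ t₀ ∧ t₀ < τ ∧ (∀ t ∈ Ioo t₀ τ, 0 < P t) ∧
      P t₀ ≤ 1 ∧ U t₀ ≤ 0 := by
    by_cases h : ∃ t ∈ Icc 0 τ, P t ≤ 0
    · have hcl : IsCompact (Icc 0 τ ∩ P ⁻¹' Iic 0) :=
        isCompact_Icc.of_isClosed_subset (hPc.preimage_isClosed_of_isClosed isClosed_Icc isClosed_Iic)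
          inter_subset_left
      obtain ⟨t₀, ⟨hI, hle⟩, hmax⟩ := hcl.exists_isGreatest
        (by obtain ⟨t, ht, hPt⟩ := h; exact ⟨t, ht, hPt⟩)
      have hle : P t₀ ≤ 0 := hle
      have hlt : t₀ < τ := lt_of_le_of_ne hI.2 fun h => by rw [h] at hle; linarith
      have hgt : 0 < t₀ := lt_of_le_of_ne hI.1 fun h => by rw [← h, hP0] at hle; linarith
      have hpos : ∀ t ∈ Ioo t₀ τ, 0 < P t := fun t ht => by
        by_contra! hc
        exact absurd (hmax ⟨⟨hI.1.trans ht.1.le, ht.2.le⟩, hc⟩) (not_le.2 ht.1)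
      have hz : P t₀ = 0 := by
        obtain ⟨s, hs, hs0⟩ := intermediate_value_Icc hlt.le
          (hPc.mono (Icc_subset_Icc_left hI.1)) ⟨hle, by linarith⟩
        have hst : s ≤ t₀ := hmax ⟨⟨hI.1.trans hs.1, hs.2⟩, hs0.le⟩
        rwa [le_antisymm hst hs.1] at hs0
      exact ⟨t₀, hI.1, hlt, hpos, by linarith, (hneg t₀ ⟨hgt, hlt.le⟩ hz).le⟩
    · push Not at h
      exact ⟨0, le_rfl, hτ, fun t ht => h t (Ioo_subset_Icc_self ht), hP0.le, hU0.le⟩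
  have hUneg : ∀ t ∈ Ioo t₀ τ, U t < 0 := fun t ht => by
    refine lt_of_lt_of_le (hU.lt_of_ae_deriv_neg ht₀ ht.1 ht.2.le ?_) hU1
    filter_upwards [hd] with x hx hxI
    obtain ⟨l, m, hl, hm, -, h⟩ := hx ⟨ht₀.trans hxI.1.le, hxI.2.le.trans ht.2.le⟩
    rw [h.deriv]
    have := mul_pos hm (hpos x ⟨hxI.1, hxI.2.trans ht.2⟩)
    linarith
  have : P τ < P t₀ := by
    refine hP.lt_of_ae_deriv_neg ht₀ hτ₀ le_rfl ?_
    filter_upwards [hd] with x hx hxI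
    obtain ⟨l, m, hl, hm, h, -⟩ := hx ⟨ht₀.trans hxI.1.le, hxI.2.le⟩
    rw [h.deriv]
    exact mul_neg_of_pos_of_neg hl (hUneg x hxI)
  linarith

theorem coverRow_zero : coverRow (0, 0) = (1, 0) := by simp [coverRow]

theorem coverRow_fst_re (q : CSU) :
    (coverRow q).1.re = √(1 + ‖q.2‖ ^ 2) * Real.cos q.1 := by
  rw [coverRow_fst_eq, Complex.re_ofReal_mul, Complex.exp_ofReal_mul_I_re]

theorem coverRow_fst_im (q : CSU) :
    (coverRow q).1.im = √(1 + ‖q.2‖ ^ 2) * Real.sin q.1 := by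
  rw [coverRow_fst_eq, Complex.im_ofReal_mul, Complex.exp_ofReal_mul_I_im]

theorem coverRow_re_im (q : CSU) :
    (coverRow q).1.re ^ 2 + (coverRow q).1.im ^ 2 = 1 + q.2.re ^ 2 + q.2.im ^ 2 := by
  have h := norm_sq_coverRow_fst q
  rw [Complex.sq_norm, Complex.sq_norm, Complex.normSq_apply, Complex.normSq_apply] at h
  linarith

/-- The first entry z₁ is not globally Lipschitz in (c, w). Its absolute continuity along a curve is
obtained from the product of this Lipschitz modulus with cos c or sin c. -/
theorem lipschitzWith_sqrt_one_add_norm_sq :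
    LipschitzWith 1 fun w : ℂ => √(1 + ‖w‖ ^ 2) := by
  refine LipschitzWith.of_dist_le_mul fun x y => ?_
  rw [NNReal.coe_one, one_mul, Real.dist_eq]
  refine le_trans ?_ (dist_eq_norm x y ▸ abs_norm_sub_norm_le x y)
  have h1 : √(1 + ‖x‖ ^ 2) ^ 2 = 1 + ‖x‖ ^ 2 := Real.sq_sqrt (by positivity)
  have h2 : √(1 + ‖y‖ ^ 2) ^ 2 = 1 + ‖y‖ ^ 2 := Real.sq_sqrt (by positivity)
  have h3 : ‖x‖ ≤ √(1 + ‖x‖ ^ 2) := Real.le_sqrt_of_sq_le (by linarith)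
  have h4 : ‖y‖ ≤ √(1 + ‖y‖ ^ 2) := Real.le_sqrt_of_sq_le (by linarith)
  have h5 : 0 < √(1 + ‖x‖ ^ 2) := Real.sqrt_pos.2 (by positivity)
  have h6 : 0 < √(1 + ‖y‖ ^ 2) := Real.sqrt_pos.2 (by positivity)
  have h7 : (√(1 + ‖x‖ ^ 2) - √(1 + ‖y‖ ^ 2)) * (√(1 + ‖x‖ ^ 2) + √(1 + ‖y‖ ^ 2))
      = (‖x‖ - ‖y‖) * (‖x‖ + ‖y‖) := by linear_combination h1 - h2
  have h8 := congrArg abs h7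
  rw [abs_mul, abs_mul, abs_of_pos (add_pos h5 h6),
    abs_of_nonneg (add_nonneg (norm_nonneg x) (norm_nonneg y))] at h8
  have h9 : |‖x‖ - ‖y‖| * (‖x‖ + ‖y‖)
      ≤ |‖x‖ - ‖y‖| * (√(1 + ‖x‖ ^ 2) + √(1 + ‖y‖ ^ 2)) :=
    mul_le_mul_of_nonneg_left (by linarith) (abs_nonneg _)
  rw [← h8] at h9
  exact le_of_mul_le_mul_right h9 (add_pos h5 h6)

section

variable {γ : ℝ → CSU} {a b : ℝ}

theorem AbsolutelyContinuousOnInterval.sqrt_one_add_norm_sq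
    (h : AbsolutelyContinuousOnInterval γ a b) :
    AbsolutelyContinuousOnInterval (fun t => √(1 + ‖(γ t).2‖ ^ 2)) a b :=
  lipschitzWith_sqrt_one_add_norm_sq.comp_absolutelyContinuousOnInterval
    (LipschitzWith.prod_snd.comp_absolutelyContinuousOnInterval h)

theorem AbsolutelyContinuousOnInterval.coverRow_fst_re
    (h : AbsolutelyContinuousOnInterval γ a b) :
    AbsolutelyContinuousOnInterval (fun t => (coverRow (γ t)).1.re) a b := by
  simp only [_root_.coverRow_fst_re]
  exact h.sqrt_one_add_norm_sq.fun_mul (Real.lipschitzWith_cos.comp_absolutelyContinuousOnInterval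
    (LipschitzWith.prod_fst.comp_absolutelyContinuousOnInterval h))

theorem AbsolutelyContinuousOnInterval.coverRow_fst_im
    (h : AbsolutelyContinuousOnInterval γ a b) :
    AbsolutelyContinuousOnInterval (fun t => (coverRow (γ t)).1.im) a b := by
  simp only [_root_.coverRow_fst_im]
  exact h.sqrt_one_add_norm_sq.fun_mul (Real.lipschitzWith_sin.comp_absolutelyContinuousOnInterval
    (LipschitzWith.prod_fst.comp_absolutelyContinuousOnInterval h))

theorem AbsolutelyContinuousOnInterval.snd_re (h : AbsolutelyContinuousOnInterval γ a b) :
    AbsolutelyContinuousOnInterval (fun t => (γ t).2.re) a b :=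
  LipschitzWith.comp_absolutelyContinuousOnInterval (g := Complex.re)
    (LipschitzWith.of_dist_le_mul fun x y => by
      rw [NNReal.coe_one, one_mul, Real.dist_eq, ← Complex.sub_re, dist_eq_norm]
      exact Complex.abs_re_le_norm _)
    (LipschitzWith.prod_snd.comp_absolutelyContinuousOnInterval h)

theorem AbsolutelyContinuousOnInterval.snd_im (h : AbsolutelyContinuousOnInterval γ a b) :
    AbsolutelyContinuousOnInterval (fun t => (γ t).2.im) a b :=
  LipschitzWith.comp_absolutelyContinuousOnInterval (g := Complex.im)
    (LipschitzWith.of_dist_le_mul fun x y => by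
      rw [NNReal.coe_one, one_mul, Real.dist_eq, ← Complex.sub_im, dist_eq_norm]
      exact Complex.abs_im_le_norm _)
    (LipschitzWith.prod_snd.comp_absolutelyContinuousOnInterval h)

end

/-- The boundary value function of the sub-Lorentzian future. -/
noncomputable def subBoundary (w : ℂ) : ℝ :=
  Complex.arg (((1 - |w.re| : ℝ) : ℂ) - Complex.I * ((√(w.im ^ 2 + 2 * |w.re|) : ℝ) : ℂ))

theorem subBoundary_nonpos (w : ℂ) : subBoundary w ≤ 0 := by
  rw [subBoundary]
  set s := √(w.im ^ 2 + 2 * |w.re|) with hs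
  have hs0 : 0 ≤ s := Real.sqrt_nonneg _
  rcases hs0.eq_or_lt with h | h
  · have h1 := Real.sqrt_eq_zero'.1 h.symm
    have h2 : |w.re| = 0 := by
      have := abs_nonneg w.re
      nlinarith [sq_nonneg w.im]
    rw [← h, h2]
    simp
  · refine (Complex.arg_neg_iff.2 ?_).le
    simpa using h

/-- The complex number ζ defining the boundary has the same modulus √(1 + |w|²) as z₁. Comparing
arguments in [-π, 0] therefore amounts to comparing real parts, since cosine is strictly monotone
there. -/
theorem lt_subBoundary_iff {q : CSU} (h1 : -Real.pi ≤ q.1) (h2 : q.1 ≤ 0) :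
    q.1 < subBoundary q.2 ↔ (coverRow q).1.re < 1 - |q.2.re| := by
  have hb0 := subBoundary_nonpos q.2
  have hb1 : -Real.pi < subBoundary q.2 := Complex.neg_pi_lt_arg _
  rw [coverRow_fst_re]
  set ζ : ℂ := ((1 - |q.2.re| : ℝ) : ℂ) - Complex.I * ((√(q.2.im ^ 2 + 2 * |q.2.re|) : ℝ) : ℂ)
    with hζ
  have hr : 0 < √(1 + ‖q.2‖ ^ 2) := Real.sqrt_pos.2 (by positivity)
  have hre : ζ.re = 1 - |q.2.re| := by simp [hζ]
  have him : ζ.im = -√(q.2.im ^ 2 + 2 * |q.2.re|) := by simp [hζ]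
  have hn : ‖ζ‖ = √(1 + ‖q.2‖ ^ 2) := by
    rw [Complex.norm_eq_sqrt_sq_add_sq, hre, him, neg_sq, Real.sq_sqrt (by positivity),
      Complex.sq_norm, Complex.normSq_apply]
    congr 1
    nlinarith [sq_abs q.2.re]
  have hζ0 : ζ ≠ 0 := norm_pos_iff.1 (hn ▸ hr)
  have hcos : √(1 + ‖q.2‖ ^ 2) * Real.cos (subBoundary q.2) = 1 - |q.2.re| := by
    rw [← hn, ← hre]
    exact Complex.norm_mul_cos_arg ζ
  rw [← hcos, mul_lt_mul_iff_right₀ hr, ← Real.cos_neg q.1, ← Real.cos_neg (subBoundary q.2),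
    Real.strictAntiOn_cos.lt_iff_gt ⟨by linarith, by linarith⟩ ⟨by linarith, by linarith⟩]
  exact neg_lt_neg_iff.symm

/-- The first row of `π ∘ γ` along a horizontal timelike curve. -/
theorem hasDerivAt_coverRow_comp {γ : ℝ → CSU} {t a : ℝ} {b : ℂ}
    (h : HasDerivAt γ (leftField (su11Mk a b) (γ t)) t) :
    HasDerivAt (fun s => (coverRow (γ s)).1)
        ((coverRow (γ t)).1 * (a * I) + (coverRow (γ t)).2 * conj b) t ∧
      HasDerivAt (fun s => (γ s).2)
        ((coverRow (γ t)).1 * b - (coverRow (γ t)).2 * (a * I)) t := by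
  have h1 := (coverRow_differentiable (γ t)).hasFDerivAt.comp_hasDerivAt t h
  rw [fderiv_coverRow_of_mcForm (mcForm_leftField _ _)] at h1
  exact ⟨(ContinuousLinearMap.fst ℝ ℂ ℂ).hasFDerivAt.comp_hasDerivAt t h1,
    (ContinuousLinearMap.snd ℝ ℂ ℂ).hasFDerivAt.comp_hasDerivAt t h1⟩

theorem fst_lt_subBoundary_of_mem {q : CSU}
    (h : q ∈ timelikeFuture distE lorMetric (leftField lieZ) (0, 0)) :
    q.1 < subBoundary q.2 := by
  obtain ⟨τ, γ, hτ, hac, h0, rfl, hd⟩ := h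
  have hac1 : AbsolutelyContinuousOnInterval (fun t => (γ t).1) 0 τ :=
    LipschitzWith.prod_fst.comp_absolutelyContinuousOnInterval hac
  rw [ae_restrict_iff' measurableSet_Icc] at hd
  have hd' : ∀ᵐ t, t ∈ Set.Icc 0 τ → ∃ a b, HasDerivAt γ (leftField (su11Mk a b) (γ t)) t ∧
      ‖b‖ < -a ∧ b.re = 0 := by
    filter_upwards [hd] with t ht htI
    obtain ⟨hdiff, hE, hl1, hl2⟩ := ht htI
    obtain ⟨a, b, hv, hab⟩ := exists_control_of_future hl1 hl2
    have hγ := hdiff.hasDerivAt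
    rw [hv] at hγ hE
    exact ⟨a, b, hγ, hab, (leftField_mem_distE_iff _ _ _).1 hE⟩
  clear hd
  -- A principal argument exceeds -π, so only an end point with c > -π matters. As c decreases, the
  -- whole curve after time 0 then has -π < c < 0, where Im z₁ < 0.
  rcases le_or_gt (γ τ).1 (-Real.pi) with hle | hgt
  · exact hle.trans_lt (Complex.neg_pi_lt_arg _)
  have hmono : ∀ s t, 0 ≤ s → s < t → t ≤ τ → (γ t).1 < (γ s).1 := fun s t h1 h2 h3 => by
    refine hac1.lt_of_ae_deriv_neg h1 h2 h3 ?_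
    filter_upwards [hd'] with x hx hxI
    obtain ⟨a, b, hγ, hab, -⟩ := hx ⟨h1.trans hxI.1.le, hxI.2.le.trans h3⟩
    have hc : HasDerivAt (fun s => (γ s).1) (leftField (su11Mk a b) (γ x)).1 x :=
      (ContinuousLinearMap.fst ℝ ℝ ℂ).hasFDerivAt.comp_hasDerivAt x hγ
    rw [hc.deriv]
    exact leftField_fst_neg _ hab
  have hneg : ∀ t ∈ Set.Ioc 0 τ, (γ t).1 < 0 := fun t ht => by
    simpa [h0] using hmono 0 t le_rfl ht.1 ht.2
  have him : ∀ t ∈ Set.Ioc 0 τ, (coverRow (γ t)).1.im < 0 := fun t ht => by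
    rw [coverRow_fst_im]
    refine mul_neg_of_pos_of_neg (Real.sqrt_pos.2 (by positivity)) ?_
    refine Real.sin_neg_of_neg_of_neg_pi_lt (hneg t ht) ?_
    rcases ht.2.eq_or_lt with h | h
    · rwa [h]
    · exact hgt.trans (hmono t τ ht.1.le h le_rfl)
  have hder : ∀ᵐ t, t ∈ Set.Icc 0 τ → ∃ a y : ℝ, |y| < -a ∧
      HasDerivAt (fun s => (coverRow (γ s)).1.re)
        (-a * (coverRow (γ t)).1.im + y * (γ t).2.im) t ∧
      HasDerivAt (fun s => (coverRow (γ s)).1.im)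
        (a * (coverRow (γ t)).1.re - y * (γ t).2.re) t ∧
      HasDerivAt (fun s => (γ s).2.re) (-y * (coverRow (γ t)).1.im + a * (γ t).2.im) t ∧
      HasDerivAt (fun s => (γ s).2.im) (y * (coverRow (γ t)).1.re - a * (γ t).2.re) t := by
    filter_upwards [hd'] with t ht htI
    obtain ⟨a, b, hγ, hab, hb⟩ := ht htI
    obtain ⟨h1, h2⟩ := hasDerivAt_coverRow_comp hγ
    have h3 : (coverRow (γ t)).2 = (γ t).2 := rfl
    rw [h3] at h1 h2
    refine ⟨a, b.im, (Complex.abs_im_le_norm b).trans_lt hab, ?_, ?_, ?_, ?_⟩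
    · exact (Complex.reCLM.hasFDerivAt.comp_hasDerivAt t h1).congr_deriv (by simp [hb]; ring)
    · exact (Complex.imCLM.hasFDerivAt.comp_hasDerivAt t h1).congr_deriv (by simp [hb]; ring)
    · exact (Complex.reCLM.hasFDerivAt.comp_hasDerivAt t h2).congr_deriv (by simp [hb]; ring)
    · exact (Complex.imCLM.hasFDerivAt.comp_hasDerivAt t h2).congr_deriv (by simp [hb]; ring)
  have hplus : (coverRow (γ τ)).1.re + (γ τ).2.re < 1 := by
    refine lt_one_of_rotating (P := fun t => (coverRow (γ t)).1.re + (γ t).2.re)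
      (U := fun t => (coverRow (γ t)).1.im - (γ t).2.im) hτ (hac.coverRow_fst_re.add hac.snd_re)
      (hac.coverRow_fst_im.sub hac.snd_im) (by simp [coverRow_zero, h0]) (by simp [coverRow_zero, h0]) ?_ ?_
    · filter_upwards [hder] with t ht htI
      obtain ⟨a, y, hy, d1, d2, d3, d4⟩ := ht htI
      obtain ⟨hy1, hy2⟩ := abs_lt.1 hy
      -- Positivity of both coefficients is exactly the timelike condition |y| < -a.
      refine ⟨-(a + y), y - a, by linarith, by linarith, ?_, ?_⟩
      · exact (d1.add d3).congr_deriv (by ring)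
      · exact (d2.sub d4).congr_deriv (by ring)
    · intro t ht hP
      have h1 := him t ht
      have h2 := coverRow_re_im (γ t)
      have h3 : (coverRow (γ t)).1.re = -(γ t).2.re := by linarith
      rw [h3] at h2
      -- With P = 0 the identity PM + UV = 1 gives UV = 1, while U + V = 2 Im z₁ < 0; so U ≥ 0 is
      -- impossible.
      by_contra! hc
      nlinarith [mul_nonneg hc (by linarith : 0 ≤ -((coverRow (γ t)).1.im + (γ t).2.im))]
  have hminus : (coverRow (γ τ)).1.re - (γ τ).2.re < 1 := by
    refine lt_one_of_rotating (P := fun t => (coverRow (γ t)).1.re - (γ t).2.re)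
      (U := fun t => (coverRow (γ t)).1.im + (γ t).2.im) hτ (hac.coverRow_fst_re.sub hac.snd_re)
      (hac.coverRow_fst_im.add hac.snd_im) (by simp [coverRow_zero, h0]) (by simp [coverRow_zero, h0]) ?_ ?_
    · filter_upwards [hder] with t ht htI
      obtain ⟨a, y, hy, d1, d2, d3, d4⟩ := ht htI
      obtain ⟨hy1, hy2⟩ := abs_lt.1 hy
      refine ⟨y - a, -(a + y), by linarith, by linarith, ?_, ?_⟩
      · exact (d1.sub d3).congr_deriv (by ring)
      · exact (d2.add d4).congr_deriv (by ring)
    · intro t ht hP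
      have h1 := him t ht
      have h2 := coverRow_re_im (γ t)
      have h3 : (coverRow (γ t)).1.re = (γ t).2.re := by linarith
      rw [h3] at h2
      by_contra! hc
      nlinarith [mul_nonneg hc (by linarith : 0 ≤ -((coverRow (γ t)).1.im - (γ t).2.im))]
  rw [lt_subBoundary_iff hgt.le (hneg τ ⟨hτ, le_rfl⟩).le]
  rcases abs_cases (γ τ).2.re with ⟨h, -⟩ | ⟨h, -⟩ <;> rw [h] <;> linarith

/-! ### The sub-Lorentzian future: reaching every point -/

/-- Points in one fibre of the covering differ by a multiple of 2π in c. This turns matrix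
identities in SU(1,1) into identities on the cover. -/
theorem eq_of_coverRow_eq {q q' : CSU} (h : coverRow q = coverRow q')
    (h1 : q.1 - q'.1 < 2 * Real.pi) (h2 : q'.1 - q.1 < 2 * Real.pi) : q = q' := by
  have hs : q.2 = q'.2 := congrArg (fun p : ℂ × ℂ => p.2) h
  have hf : (coverRow q).1 = (coverRow q').1 := congrArg (fun p : ℂ × ℂ => p.1) h
  rw [coverRow_fst_eq, coverRow_fst_eq, hs] at hf
  have hr : ((√(1 + ‖q'.2‖ ^ 2) : ℝ) : ℂ) ≠ 0 := by
    exact_mod_cast (Real.sqrt_pos.2 (by positivity : (0 : ℝ) < 1 + ‖q'.2‖ ^ 2)).ne'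
  obtain ⟨n, hn⟩ := Complex.exp_eq_exp_iff_exists_int.1 (mul_left_cancel₀ hr hf)
  have hn' := congrArg Complex.im hn
  have hq : q.1 = q'.1 + n * (2 * Real.pi) := by simpa using hn'
  have hpi := Real.pi_pos
  have hn1 : (n : ℝ) < 1 := by nlinarith
  have hn2 : (-1 : ℝ) < n := by nlinarith
  have hn3 : n = 0 := by
    have : n < 1 := by exact_mod_cast hn1
    have : -1 < n := by exact_mod_cast hn2
    omega
  refine Prod.ext ?_ hs
  simpa [hn3] using hq

/-- The point reached by a rotation of parameter `t`. -/
theorem rotate_mem_timelikeFuture (c : ℝ) (w : ℂ) {t : ℝ} (ht : 0 < t) :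
    ((c - t, w * Complex.exp (t * I)) : CSU)
      ∈ timelikeFuture distE lorMetric (leftField lieZ) (c, w) := by
  let γ : ℝ → CSU := fun s => (c - s, w * Complex.exp (s * I))
  have h0 : γ 0 = (c, w) := by simp [γ]
  rw [← h0]
  refine mem_timelikeFuture_of_hasDerivAt (γ := γ) ht ?_ fun s _ => ⟨-1, 0, ?_, by simp, ?_⟩
  · refine ContDiffOn.absolutelyContinuousOnInterval (ContDiff.contDiffOn ?_)
    exact (contDiff_const.sub contDiff_id).prodMk (contDiff_const.mul
      ((Complex.ofRealCLM.contDiff.mul contDiff_const).cexp))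
  · rw [leftField_su11Mk]
    refine HasDerivAt.prodMk ?_ ?_
    · simpa using (hasDerivAt_id s).const_sub c
    · have h1 := (((hasDerivAt_id s).ofReal_comp.mul_const I).cexp).const_mul w
      refine h1.congr_deriv ?_
      simp [coverRow, γ]
      ring
  · rw [leftField_mem_distE_iff]; simp

/-- The flow of the timelike unit vector `(ia, iy; -iy, -ia)` for a time `θ < π`. -/
theorem exists_flow_mem_timelikeFuture (q₀ : CSU) {a y θ : ℝ} (ha : a < 0) (hay : a ^ 2 = 1 + y ^ 2)
    (hθ0 : 0 < θ) (hθ1 : θ < Real.pi) :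
    ∃ q ∈ timelikeFuture distE lorMetric (leftField lieZ) q₀, q₀.1 - Real.pi < q.1 ∧ q.1 < q₀.1 ∧
      coverRow q = ((coverRow q₀).1 * (Real.cos θ + a * Real.sin θ * I)
          - q₀.2 * (y * Real.sin θ * I),
        (coverRow q₀).1 * (y * Real.sin θ * I)
          + q₀.2 * (Real.cos θ - a * Real.sin θ * I)) := by
  set z := (coverRow q₀).1 with hzdef
  have hz : z ≠ 0 := coverRow_fst_ne q₀
  set w := q₀.2 with hwdef
  have hya : |y| < -a := abs_lt_of_sq_lt_sq (by nlinarith) (by linarith)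
  -- The generator A squares to -1 because a² = 1 + y², so exp(tA) = cos t + A sin t; Z and W are
  -- the first row of π(q₀) exp(tA). The quotient u = Z / z has negative imaginary part for 0 < t <
  -- π, so log u lifts the curve and c drops by less than π.
  let Z : ℝ → ℂ := fun t => z * (Real.cos t + a * Real.sin t * I) - w * (y * Real.sin t * I)
  let W : ℝ → ℂ := fun t => z * (y * Real.sin t * I) + w * (Real.cos t - a * Real.sin t * I)
  let u : ℝ → ℂ := fun t => Real.cos t + Real.sin t * ((a - y * (w / z)) * I)
  have hZu : ∀ t, Z t = z * u t := fun t => by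
    simp only [Z, u]; field_simp; ring
  have hslope : a - y * (w / z).re < 0 := by
    have h1 : |(w / z).re| ≤ 1 := by
      refine (Complex.abs_re_le_norm _).trans ?_
      rw [norm_div]
      exact div_le_one_of_le₀ (norm_snd_lt_norm_coverRow_fst q₀).le (norm_nonneg _)
    have h2 : |y * (w / z).re| ≤ |y| := by
      rw [abs_mul]; exact mul_le_of_le_one_right (abs_nonneg _) h1
    linarith [neg_abs_le (y * (w / z).re)]
  have huim : ∀ t, (u t).im = Real.sin t * (a - y * (w / z).re) := fun t => by
    simp only [u, Complex.add_im, Complex.ofReal_im, Complex.im_ofReal_mul, Complex.mul_I_im,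
      Complex.sub_re, Complex.ofReal_re, Complex.re_ofReal_mul, zero_add]
  have huneg : ∀ t, 0 < t → t < Real.pi → (u t).im < 0 := fun t h1 h2 => by
    rw [huim]
    exact mul_neg_of_pos_of_neg (Real.sin_pos_of_pos_of_lt_pi h1 h2) hslope
  have huslit : ∀ t ∈ Set.Icc 0 θ, u t ∈ Complex.slitPlane := fun t ht => by
    rcases ht.1.eq_or_lt with h | h
    · rw [← h]; simp [u]
    · exact Or.inr (huneg t h (ht.2.trans_lt hθ1)).ne
  let γ : ℝ → CSU := fun t => (q₀.1 + (Complex.log (u t)).im, W t)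
  have hnorm : ∀ t, √(1 + ‖W t‖ ^ 2) = ‖Z t‖ := fun t => by
    have h : Z t * conj (Z t) - W t * conj (W t) = 1 := by
      have h0 := coverRow_conj q₀
      have hcs : (Real.cos t : ℂ) ^ 2 + (Real.sin t : ℂ) ^ 2 = 1 := by
        exact_mod_cast Real.cos_sq_add_sin_sq t
      have hay' : (a : ℂ) ^ 2 = 1 + y ^ 2 := by exact_mod_cast hay
      change z * conj z - w * conj w = 1 at h0
      simp only [Z, W, map_sub, map_add, map_mul, Complex.conj_ofReal, Complex.conj_I]
      generalize (Real.cos t : ℂ) = co at *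
      generalize (Real.sin t : ℂ) = si at *
      have hI : I ^ 2 = -1 := Complex.I_sq
      grind
    rw [Complex.mul_conj, Complex.mul_conj, Complex.normSq_eq_norm_sq,
      Complex.normSq_eq_norm_sq] at h
    have h' : ‖Z t‖ ^ 2 - ‖W t‖ ^ 2 = 1 := by exact_mod_cast h
    rw [show 1 + ‖W t‖ ^ 2 = ‖Z t‖ ^ 2 by linarith, Real.sqrt_sq (norm_nonneg _)]
  have hcov : ∀ t, coverRow (γ t) = (Z t, W t) := fun t => by
    refine Prod.ext ?_ rfl
    rw [coverRow_fst_eq]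
    simp only [γ, hnorm]
    have h1 : z = (‖z‖ : ℂ) * Complex.exp (q₀.1 * I) := by
      have : ‖z‖ = √(1 + ‖q₀.2‖ ^ 2) := by
        rw [← norm_sq_coverRow_fst, Real.sqrt_sq (norm_nonneg _)]
      rw [this]; rfl
    have h2 := Complex.norm_mul_exp_arg_mul_I (u t)
    rw [hZu, norm_mul, Complex.log_im]
    conv_rhs => rw [h1, ← h2]
    push_cast
    rw [add_mul, Complex.exp_add]
    ring
  have hZ0 : ∀ t, t ∈ Set.Icc 0 θ → Z t ≠ 0 := fun t ht => by
    rw [hZu]; exact mul_ne_zero hz (Complex.slitPlane_ne_zero (huslit t ht))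
  have hγ0 : γ 0 = q₀ := by simp [γ, u, W, hwdef]
  have hcosd : ∀ t, HasDerivAt (fun s : ℝ => (Real.cos s : ℂ)) (-(Real.sin t : ℂ)) t := fun t => by
    simpa using (Real.hasDerivAt_cos t).ofReal_comp
  have hsind : ∀ t, HasDerivAt (fun s : ℝ => (Real.sin s : ℂ)) (Real.cos t : ℂ) t := fun t =>
    (Real.hasDerivAt_sin t).ofReal_comp
  refine ⟨γ θ, ?_, ?_, ?_, hcov θ⟩
  · suffices h : γ θ ∈ timelikeFuture distE lorMetric (leftField lieZ) (γ 0) by rwa [hγ0] at h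
    refine mem_timelikeFuture_of_hasDerivAt (γ := γ) hθ0 ?_ fun t ht => ⟨a, y * I, ?_, ?_, ?_⟩
    · refine ContDiffOn.absolutelyContinuousOnInterval fun t ht => ContDiffAt.contDiffWithinAt ?_
      rw [Set.uIcc_of_le hθ0.le] at ht
      have hc : ContDiffAt ℝ 1 (fun s : ℝ => (Real.cos s : ℂ)) t :=
        (Complex.ofRealCLM.contDiff.comp Real.contDiff_cos).contDiffAt
      have hs : ContDiffAt ℝ 1 (fun s : ℝ => (Real.sin s : ℂ)) t :=
        (Complex.ofRealCLM.contDiff.comp Real.contDiff_sin).contDiffAt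
      refine ContDiffAt.prodMk (contDiffAt_const.add ?_) ?_
      · refine Complex.imCLM.contDiff.contDiffAt.comp (f := fun s => Complex.log (u s)) t ?_
        refine ((Complex.contDiffAt_log (huslit t ht)).restrict_scalars ℝ).comp t ?_
        exact hc.add (hs.mul contDiffAt_const)
      · exact (contDiffAt_const.mul ((contDiffAt_const.mul hs).mul contDiffAt_const)).add
          (contDiffAt_const.mul (hc.sub ((contDiffAt_const.mul hs).mul contDiffAt_const)))
    · have htI : t ∈ Set.Icc 0 θ := Set.Ioo_subset_Icc_self ht
      rw [leftField_su11Mk, hcov]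
      refine HasDerivAt.prodMk ?_ ?_
      · have h1 : HasDerivAt u (-(Real.sin t : ℂ) + Real.cos t * ((a - y * (w / z)) * I)) t :=
          (hcosd t).add ((hsind t).mul_const _)
        have h2 := (Complex.imCLM.hasFDerivAt.comp_hasDerivAt t
          (h1.clog_real (huslit t htI))).const_add q₀.1
        refine h2.congr_deriv ?_
        -- Both sides are the logarithmic derivative Z' / Z, as u differs from Z by a constant
        -- factor.
        have h3 : (-(Real.sin t : ℂ) + Real.cos t * ((a - y * (w / z)) * I)) / u t
            = a * I + W t * conj (y * I : ℂ) / Z t := by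
          have hay' : (a : ℂ) ^ 2 = 1 + y ^ 2 := by exact_mod_cast hay
          have hzw : w / z * z = w := div_mul_cancel₀ w hz
          have hZt := hZ0 t htI
          have hut := Complex.slitPlane_ne_zero (huslit t htI)
          rw [div_eq_iff hut]
          have h4 : W t * conj (y * I : ℂ) / Z t * u t = W t * (-(y * I)) / z := by
            rw [hZu]
            simp only [map_mul, Complex.conj_ofReal, Complex.conj_I]
            field_simp
          rw [add_mul, h4]
          apply mul_right_cancel₀ hz
          rw [add_mul, add_mul, div_mul_cancel₀ _ hz]
          have h5 : a * I * u t * z = a * I * Z t := by rw [hZu]; ring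
          rw [h5]
          simp only [Z, W]
          linear_combination (-(y * Real.cos t * I) : ℂ) * hzw
            + ((y ^ 2 - a ^ 2) * z * Real.sin t : ℂ) * Complex.I_sq + (z * Real.sin t : ℂ) * hay'
        simp only [Complex.imCLM_apply, h3]
        simp
      · have h1 := (((hsind t).const_mul (y : ℂ)).mul_const I).const_mul z
        have h2 := ((hcosd t).sub (((hsind t).const_mul (a : ℂ)).mul_const I)).const_mul w
        refine (h1.add h2).congr_deriv ?_
        have hay' : (a : ℂ) ^ 2 = 1 + y ^ 2 := by exact_mod_cast hay
        simp only [Z, W]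
        linear_combination (w * Real.sin t * (y ^ 2 - a ^ 2) : ℂ) * Complex.I_sq
          + (w * Real.sin t : ℂ) * hay'
    · rw [norm_mul, Complex.norm_I, mul_one, Complex.norm_real]; exact hya
    · rw [leftField_mem_distE_iff]; simp
  · simp only [γ, Complex.log_im]
    linarith [Complex.neg_pi_lt_arg (u θ)]
  · simp only [γ, Complex.log_im]
    linarith [Complex.arg_neg_iff.2 (huneg θ hθ0 hθ1)]

/-- With l = k and m = 1/k, a flow rotates (P, √(l/m) U) rigidly, and the four equations describe
two such flows from the identity. Setting A = 1 - P and B = 1 - M, the first two give sin² θ = AB /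
(A + B) and k₁ / k₂ = B / A. The third fixes the scale, and the fourth follows from UV = A + B - AB,
whose positivity also makes sin θ < 1. -/
theorem exists_two_controls {P M U V : ℝ} (hP : P < 1) (hM : M < 1) (hU : U < 0) (hV : V < 0)
    (h : P * M + U * V = 1) : ∃ k₁ k₂ θ : ℝ, 0 < k₁ ∧ 0 < k₂ ∧ 0 < θ ∧ θ < Real.pi ∧
      Real.cos θ ^ 2 - k₂ / k₁ * Real.sin θ ^ 2 = P ∧
      Real.cos θ ^ 2 - k₁ / k₂ * Real.sin θ ^ 2 = M ∧
      -(Real.cos θ * Real.sin θ * (1 / k₁ + 1 / k₂)) = U ∧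
      -(Real.cos θ * Real.sin θ * (k₁ + k₂)) = V := by
  obtain ⟨A, rfl⟩ : ∃ A, P = 1 - A := ⟨1 - P, by ring⟩
  obtain ⟨B, rfl⟩ : ∃ B, M = 1 - B := ⟨1 - M, by ring⟩
  have hA : 0 < A := by linarith
  have hB : 0 < B := by linarith
  have hUV : U * V = A + B - A * B := by linarith
  have hD : 0 < A + B - A * B := hUV ▸ mul_pos_of_neg_of_neg hU hV
  set s := √(A * B / (A + B)) with hs
  have hs2 : s ^ 2 = A * B / (A + B) := Real.sq_sqrt (by positivity)
  have hs0 : 0 < s := Real.sqrt_pos.2 (by positivity)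
  have hs1 : s < 1 := by
    have : s ^ 2 < 1 := by rw [hs2, div_lt_one (by positivity)]; linarith
    nlinarith
  have hsin : Real.sin (Real.arcsin s) = s := Real.sin_arcsin (by linarith) hs1.le
  have hθ0 : 0 < Real.arcsin s := Real.arcsin_pos.2 hs0
  have hθ1 : Real.arcsin s < Real.pi / 2 := Real.arcsin_lt_pi_div_two.2 hs1
  have hc0 : 0 < Real.cos (Real.arcsin s) := Real.cos_pos_of_mem_Ioo ⟨by linarith, hθ1⟩
  have hcs := Real.sin_sq_add_cos_sq (Real.arcsin s)
  rw [hsin] at hcs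
  set c := Real.cos (Real.arcsin s) with hc
  have hc2 : c ^ 2 = (A + B - A * B) / (A + B) := by
    have : c ^ 2 = 1 - s ^ 2 := by linarith
    rw [this, hs2]; field_simp
  have hU0 : U ≠ 0 := hU.ne
  refine ⟨s * c * (A + B) / (A * -U), s * c * (A + B) / (B * -U), Real.arcsin s,
    div_pos (by positivity) (mul_pos hA (by linarith)),
    div_pos (by positivity) (mul_pos hB (by linarith)), hθ0, by linarith [Real.pi_pos], ?_, ?_, ?_,
    ?_⟩
  · rw [hsin, hc2, hs2]; field_simp; ring
  · rw [hsin, hc2, hs2]; field_simp; ring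
  · rw [hsin, ← hc]; field_simp; ring
  · rw [hsin]
    have h1 : -(c * s * (s * c * (A + B) / (A * -U) + s * c * (A + B) / (B * -U)))
        = c ^ 2 * s ^ 2 * (A + B) ^ 2 / (A * B * U) := by field_simp; ring
    rw [h1, hc2, hs2]
    have h2 : V = (A + B - A * B) / U := by rw [← hUV]; field_simp
    rw [h2]
    field_simp

/-- The points of the future of the identity reached by two flows of equal duration. -/
theorem mem_timelikeFuture_of_two_flows {q : CSU} (h1 : -Real.pi < q.1) (h2 : q.1 < 0)
    (hP : (coverRow q).1.re + q.2.re < 1) (hM : (coverRow q).1.re - q.2.re < 1)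
    (hU : (coverRow q).1.im - q.2.im < 0) (hV : (coverRow q).1.im + q.2.im < 0) :
    q ∈ timelikeFuture distE lorMetric (leftField lieZ) (0, 0) := by
  obtain ⟨k₁, k₂, θ, hk₁, hk₂, hθ0, hθ1, eP, eM, eU, eV⟩ := exists_two_controls hP hM hU hV
    (by linarith [coverRow_re_im q])
  have hpos : ∀ k : ℝ, 0 < k → -(k + 1 / k) / 2 < 0 := fun k hk => by
    have : 0 < k + 1 / k := by positivity
    linarith
  have hdet : ∀ k : ℝ, 0 < k → (-(k + 1 / k) / 2) ^ 2 = 1 + ((1 / k - k) / 2) ^ 2 := fun k hk => by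
    field_simp; ring
  obtain ⟨m, hm, hm1, hm2, hm3⟩ :=
    exists_flow_mem_timelikeFuture (0, 0) (hpos k₁ hk₁) (hdet k₁ hk₁) hθ0 hθ1
  obtain ⟨p, hp, hp1, hp2, hp3⟩ :=
    exists_flow_mem_timelikeFuture m (hpos k₂ hk₂) (hdet k₂ hk₂) hθ0 hθ1
  have hm4 : m.2 = (coverRow m).2 := rfl
  rw [hm4, hm3] at hp3
  simp only [coverRow_zero] at hp3 hm1 hm2
  have hpq : p = q := by
    -- Each flow lowers c by less than π, so `p` has -2π < c < 0, while `q` has -π < c < 0.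
    refine eq_of_coverRow_eq ?_ (by linarith) (by linarith)
    rw [hp3]
    have hq2 : (coverRow q).2 = q.2 := rfl
    have e1 : k₂ / k₁ = k₂ * (1 / k₁) := by ring
    have e2 : k₁ / k₂ = k₁ * (1 / k₂) := by ring
    rw [e1] at eP
    rw [e2] at eM
    have i1 : k₁ * (1 / k₁) = 1 := by field_simp
    have i2 : k₂ * (1 / k₂) = 1 := by field_simp
    generalize 1 / k₁ = l₁ at *
    generalize 1 / k₂ = l₂ at *
    generalize Real.cos θ = co at *
    generalize Real.sin θ = si at *
    refine Prod.ext (Complex.ext ?_ ?_) (Complex.ext ?_ ?_)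
    · simp; linear_combination (eP + eM) / 2
    · simp; linear_combination (eU + eV) / 2
    · rw [hq2]; simp; linear_combination (eP - eM) / 2
    · rw [hq2]; simp; linear_combination (eV - eU) / 2
  rw [← hpq]
  exact timelikeFuture_trans hm hp

theorem rotate_mem_timelikeFuture_of_mem {q₀ : CSU} {c : ℝ} {w : ℂ} {t : ℝ} (ht : 0 ≤ t)
    (h : ((c, w) : CSU) ∈ timelikeFuture distE lorMetric (leftField lieZ) q₀) :
    ((c - t, w * Complex.exp (t * I)) : CSU)
      ∈ timelikeFuture distE lorMetric (leftField lieZ) q₀ := by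
  rcases ht.eq_or_lt with rfl | ht
  · simpa using h
  · exact timelikeFuture_trans h (rotate_mem_timelikeFuture c w ht)

/-- The points of the future of the identity reached by a quarter turn between two rotations. -/
theorem mem_timelikeFuture_of_quarter_turn {α β y : ℝ} (hα : 0 ≤ α) (hβ : 0 ≤ β) :
    ((-α - Real.pi / 2 - β, y * I * Complex.exp ((β - α : ℝ) * I)) : CSU)
      ∈ timelikeFuture distE lorMetric (leftField lieZ) (0, 0) := by
  have hpi := Real.pi_pos
  have hr : 0 < √(1 + y ^ 2) := Real.sqrt_pos.2 (by positivity)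
  obtain ⟨m, hm, hm1, hm2, hm3⟩ := exists_flow_mem_timelikeFuture (-α, 0)
    (a := -√(1 + y ^ 2)) (y := y) (θ := Real.pi / 2) (by linarith)
    (by rw [neg_sq, Real.sq_sqrt (by positivity)]) (by positivity) (by linarith)
  have hmeq : m = (-α - Real.pi / 2, y * I * Complex.exp ((-α : ℝ) * I)) := by
    refine eq_of_coverRow_eq ?_ (by simp only at hm2 ⊢; linarith) (by simp only at hm1 ⊢; linarith)
    rw [hm3]
    refine Prod.ext ?_ ?_
    · have hn : ‖(y * I * Complex.exp ((-α : ℝ) * I) : ℂ)‖ ^ 2 = y ^ 2 := by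
        rw [norm_mul, Complex.norm_exp_ofReal_mul_I, norm_mul, Complex.norm_I, Complex.norm_real]
        simp
      have he : Complex.exp (((-α - Real.pi / 2 : ℝ) : ℂ) * I)
          = Complex.exp ((-α : ℝ) * I) * -I := by
        push_cast
        rw [sub_mul, Complex.exp_sub, Complex.exp_pi_div_two_mul_I, div_eq_mul_inv, Complex.inv_I]
      rw [coverRow_fst_eq, coverRow_fst_eq, hn, he]
      simp
      ring
    · simp [coverRow]
      ring
  have h1 : m ∈ timelikeFuture distE lorMetric (leftField lieZ) (0, 0) := by
    rcases hα.eq_or_lt with h | h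
    · rw [← h] at hm; simpa using hm
    · have h2 := rotate_mem_timelikeFuture 0 0 h
      simp only [zero_sub, zero_mul] at h2
      exact timelikeFuture_trans h2 hm
  rw [hmeq] at h1
  have h2 := rotate_mem_timelikeFuture_of_mem hβ h1
  convert h2 using 2
  rw [mul_assoc (y * I : ℂ) (Complex.exp _), ← Complex.exp_add]
  congr 2
  push_cast
  ring

/-- Allowing y to have either sign brings the phase of w relative to the imaginary axis into [-π/2,
π/2]; it is the argument of -iw or iw, whichever has nonnegative real part. -/
theorem exists_phase (w : ℂ) : ∃ φ y : ℝ, |φ| ≤ Real.pi / 2 ∧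
    w = y * I * Complex.exp (φ * I) ∧ ‖w‖ * Real.cos φ = |w.im| := by
  have key : ∀ ω : ℂ, 0 ≤ ω.re → |Complex.arg ω| ≤ Real.pi / 2 ∧
      ‖ω‖ * Real.cos (Complex.arg ω) = ω.re := fun ω h =>
    ⟨Complex.abs_arg_le_pi_div_two_iff.2 h, Complex.norm_mul_cos_arg ω⟩
  rcases le_total 0 w.im with h | h
  · obtain ⟨h1, h2⟩ := key (-I * w) (by simpa using h)
    refine ⟨Complex.arg (-I * w), ‖w‖, h1, ?_, ?_⟩
    · have h3 := Complex.norm_mul_exp_arg_mul_I (-I * w)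
      rw [norm_mul, norm_neg, Complex.norm_I, one_mul] at h3
      linear_combination (-I) * h3 + w * Complex.I_sq
    · rw [norm_mul, norm_neg, Complex.norm_I, one_mul] at h2
      rw [h2, abs_of_nonneg h]; simp
  · obtain ⟨h1, h2⟩ := key (I * w) (by simpa using h)
    refine ⟨Complex.arg (I * w), -‖w‖, h1, ?_, ?_⟩
    · have h3 := Complex.norm_mul_exp_arg_mul_I (I * w)
      rw [norm_mul, Complex.norm_I, one_mul] at h3
      push_cast
      linear_combination I * h3 + w * Complex.I_sq
    · rw [norm_mul, Complex.norm_I, one_mul] at h2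
      rw [h2, abs_of_nonpos h]; simp

/-- The rotation parameters solve α + β = -π/2 - c and β - α = φ; the hypothesis says that both are
nonnegative. -/
theorem mem_timelikeFuture_of_phase {c φ y : ℝ} (h : |φ| ≤ -Real.pi / 2 - c) :
    ((c, y * I * Complex.exp (φ * I)) : CSU)
      ∈ timelikeFuture distE lorMetric (leftField lieZ) (0, 0) := by
  obtain ⟨h1, h2⟩ := abs_le.1 h
  have h3 := mem_timelikeFuture_of_quarter_turn (α := (-Real.pi / 2 - c - φ) / 2)
    (β := (-Real.pi / 2 - c + φ) / 2) (y := y) (by linarith) (by linarith)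
  convert h3 using 2
  · ring
  · congr 4; ring

theorem mem_timelikeFuture_of_fst_lt_subBoundary {q : CSU} (h : q.1 < subBoundary q.2) :
    q ∈ timelikeFuture distE lorMetric (leftField lieZ) (0, 0) := by
  have hpi := Real.pi_pos
  have hc0 : q.1 < 0 := h.trans_le (subBoundary_nonpos _)
  obtain ⟨φ, y, hφ, hw, hcos⟩ := exists_phase q.2
  have hmem : |φ| ≤ -Real.pi / 2 - q.1 →
      q ∈ timelikeFuture distE lorMetric (leftField lieZ) (0, 0) := fun h => by
    have h1 := mem_timelikeFuture_of_phase (y := y) h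
    rwa [← hw] at h1
  rcases le_or_gt q.1 (-Real.pi) with hle | hgt
  · exact hmem (by linarith)
  rw [lt_subBoundary_iff hgt.le hc0.le] at h
  have hx := abs_nonneg q.2.re
  have hx1 := le_abs_self q.2.re
  have hx2 := neg_abs_le q.2.re
  -- This condition says that U and V are both negative, which is when two flows suffice. Otherwise
  -- |z₁|² = 1 + |w|² forces Re z₁ < 0, hence c < -π/2, and the quarter-turn construction applies.
  by_cases hv : |q.2.im| < -(coverRow q).1.im
  · obtain ⟨hv1, hv2⟩ := abs_lt.1 hv
    exact mem_timelikeFuture_of_two_flows hgt hc0 (by linarith) (by linarith) (by linarith)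
      (by linarith)
  push Not at hv
  have hri := coverRow_re_im q
  have hr : 0 < √(1 + ‖q.2‖ ^ 2) := Real.sqrt_pos.2 (by positivity)
  have him : (coverRow q).1.im < 0 := by
    rw [coverRow_fst_im]
    exact mul_neg_of_pos_of_neg hr (Real.sin_neg_of_neg_of_neg_pi_lt hc0 hgt)
  have hre : (coverRow q).1.re < 0 := by
    have h1 : (coverRow q).1.im ^ 2 ≤ q.2.im ^ 2 := by
      rw [← sq_abs q.2.im, ← neg_sq]
      exact pow_le_pow_left₀ (by linarith) hv 2
    by_contra! hc
    nlinarith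
  have hc1 : q.1 < -Real.pi / 2 := by
    by_contra! hc
    rw [coverRow_fst_re] at hre
    have := Real.cos_nonneg_of_mem_Icc (x := q.1) ⟨by linarith, by linarith⟩
    nlinarith
  apply hmem
  rw [coverRow_fst_im, ← hcos] at hv
  have hwr : ‖q.2‖ < √(1 + ‖q.2‖ ^ 2) := Real.lt_sqrt_of_sq_lt (by linarith)
  have hw0 : 0 < ‖q.2‖ := by
    refine lt_of_le_of_ne (norm_nonneg _) fun h0 => ?_
    rw [coverRow_fst_im] at him
    rw [← h0] at hv him
    linarith
  have hsin : Real.cos (-Real.pi / 2 - q.1) = -Real.sin q.1 := by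
    rw [← Real.cos_neg, ← Real.cos_add_pi_div_two]; congr 1; ring
  have hs0 : 0 ≤ -Real.sin q.1 := by
    have := Real.sin_neg_of_neg_of_neg_pi_lt hc0 hgt
    linarith
  -- From |w| cos φ = |Im w| ≥ √(1 + |w|²) |sin c| ≥ |w| |sin c|; monotonicity of cosine then gives
  -- the required bound on |φ|.
  have hcc : Real.cos (-Real.pi / 2 - q.1) ≤ Real.cos |φ| := by
    rw [Real.cos_abs, hsin]
    refine le_of_mul_le_mul_left ?_ hw0
    refine le_trans ?_ hv
    nlinarith
  exact (Real.strictAntiOn_cos.le_iff_ge ⟨by linarith, by linarith⟩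
    ⟨abs_nonneg _, by linarith⟩).1 hcc

theorem mainTheorem7 :
    timelikeFuture (fun _ => ⊤) lorMetric (leftField lieZ) (0, 0)
        = {q : CSU | q.1 < -Real.arctan ‖q.2‖} ∧
    timelikeFuture distE lorMetric (leftField lieZ) (0, 0)
        = {q : CSU | q.1 < Complex.arg (((1 - |q.2.re| : ℝ) : ℂ)
            - Complex.I * ((√(q.2.im ^ 2 + 2 * |q.2.re|) : ℝ) : ℂ))} :=
  ⟨Set.ext fun _ => ⟨fst_lt_neg_arctan_of_mem, mem_timelikeFuture_of_fst_lt⟩,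
    Set.ext fun _ => ⟨fst_lt_subBoundary_of_mem, mem_timelikeFuture_of_fst_lt_subBoundary⟩⟩
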